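/- **Theorem.** The following implication is a theorem of Zermelo–Fraenkel set theory ZF (without the axiom of choice); that is, in every model of ZF in which the uniform boundedness principle holds, the axiom of partial countable asymptotic choice holds as well. *Uniform boundedness principle.* Let $X$ be a (real) Banach space, i.e. a normed space in which every Cauchy sequence converges, let $Y$ be a (real) normed space, and let $(T_\alpha)_{\alpha\in A}$ be a family, indexed by an arbitrary set $A$, of continuous linear maps $X\to Y$. If $\sup_{\alpha\in A}\|T_\alpha(x)\|_Y<\infty$ for every $x\in X$, then $\sup_{\alpha\in A}\|T_\alpha\|_{op}<\infty$. *Axiom of partial countable asymptotic choice.* Let $(S_n)_{n\in\mathbb N}$ be a sequence of finite nonempty sets, and let $(\lambda_n)_{n\in\mathbb N}$ be an unbounded sequence of positive real numbers. Then there exist an infinite set $I\subseteq\mathbb N$, a family of sets $(M_n)_{n\in I}$ and a constant $C>0$ such that for all $n\in I$ we have $M_n\subseteq S_n$, $M_n\neq\emptyset$ and $|M_n|\le C\lambda_n$. -/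

import Mathlib

/-!
Internal set theory.  A model of ZF is a type `V` with a binary relation `∈ᵥ` satisfying the axioms
of Zermelo and Fraenkel (without choice), where separation and replacement are first-order schemas
with parameters.  All notions below are the usual set-theoretic ones read inside `V`: every set,
function, family, sequence or space is an element of `V`, even if it is presented here through the
Lean function or the Lean algebraic structure that it induces on the elements of a set of `V`.
-/

universe u

namespace ZFModel

open FirstOrder

/-- A structure for the language of set theory. -/
class EpsStructure (V : Type u) where
  eps : V → V → Prop

infix:50 " ∈ᵥ " => EpsStructure.eps

inductive EpsRel : ℕ → Type
  | mem : EpsRel 2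

/-- The first-order language with a single binary relation symbol. -/
def epsLang : Language := ⟨fun _ => Empty, EpsRel⟩

instance instEpsLangStructure (V : Type u) [EpsStructure V] : epsLang.Structure V where
  funMap := fun f => f.elim
  RelMap := fun {_} r => match r with
    | EpsRel.mem => fun v => v 0 ∈ᵥ v 1

/-- The atomic formula `s ∈ t`. -/
def memFormula {α : Type*} {n : ℕ} (s t : epsLang.Term (α ⊕ Fin n)) : epsLang.BoundedFormula α n :=
  Language.BoundedFormula.rel (L := epsLang) (l := 2) EpsRel.mem ![s, t]

theorem realize_memFormula {V : Type u} [EpsStructure V] {α : Type*} {n : ℕ}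
    (s t : epsLang.Term (α ⊕ Fin n)) (v : α → V) (xs : Fin n → V) :
    (memFormula s t).Realize v xs ↔
      s.realize (Sum.elim v xs) ∈ᵥ t.realize (Sum.elim v xs) := Iff.rfl

section Predicates

variable {V : Type u} [EpsStructure V]

def IsEmptySet (e : V) : Prop := ∀ z, ¬ z ∈ᵥ e

/-- `s = x ∪ {x}`. -/
def IsSucc (s x : V) : Prop := ∀ z, z ∈ᵥ s ↔ z ∈ᵥ x ∨ z = x

def IsInductive (w : V) : Prop :=
  (∃ e, IsEmptySet e ∧ e ∈ᵥ w) ∧ ∀ x, x ∈ᵥ w → ∃ s, IsSucc s x ∧ s ∈ᵥ w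

def SubsetOf (a b : V) : Prop := ∀ z, z ∈ᵥ a → z ∈ᵥ b

end Predicates

/-- `V` is a model of ZF. The predicates `Definable₁` and `Definable₂` over `Set.univ` range over the
classes and class relations that are first-order definable with parameters from `V`. -/
class IsZF (V : Type u) [EpsStructure V] : Prop where
  extensionality : ∀ a b : V, (∀ z, z ∈ᵥ a ↔ z ∈ᵥ b) → a = b
  foundation : ∀ a : V, (∃ z, z ∈ᵥ a) → ∃ y, y ∈ᵥ a ∧ ∀ z, z ∈ᵥ a → ¬ z ∈ᵥ y
  pairing : ∀ a b : V, ∃ c, ∀ z, z ∈ᵥ c ↔ z = a ∨ z = b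
  union : ∀ a : V, ∃ c, ∀ z, z ∈ᵥ c ↔ ∃ y, y ∈ᵥ a ∧ z ∈ᵥ y
  powerset : ∀ a : V, ∃ c, ∀ z, z ∈ᵥ c ↔ SubsetOf z a
  infinity : ∃ w : V, IsInductive w
  separation : ∀ D : Set V, (Set.univ : Set V).Definable₁ epsLang D →
    ∀ a : V, ∃ b, ∀ z, z ∈ᵥ b ↔ z ∈ᵥ a ∧ z ∈ D
  replacement : ∀ F : Set (V × V), (Set.univ : Set V).Definable₂ epsLang F →
    ∀ a : V, (∀ x, x ∈ᵥ a → ∀ y y', (x, y) ∈ F → (x, y') ∈ F → y = y') →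
      ∃ b, ∀ y, y ∈ᵥ b ↔ ∃ x, x ∈ᵥ a ∧ (x, y) ∈ F

variable {V : Type u} [EpsStructure V] [IsZF V]

section Basic

theorem exists_omega (V : Type u) [EpsStructure V] [IsZF V] :
    ∃ w : V, ∀ x, x ∈ᵥ w ↔ ∀ w' : V, IsInductive w' → x ∈ᵥ w' := by
  obtain ⟨w, hw⟩ := IsZF.infinity (V := V)
  have hD : (Set.univ : Set V).Definable₁ epsLang {x : V | ∀ w' : V, IsInductive w' → x ∈ᵥ w'} := by
    refine Set.Definable.mono (Set.empty_definable_iff.2 ?_) (Set.empty_subset _)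
    let v {n : ℕ} (i : Fin n) : epsLang.Term (Fin 1 ⊕ Fin n) := Language.Term.var (Sum.inr i)
    let emp : epsLang.BoundedFormula (Fin 1) 1 :=
      (((memFormula (v 2) (v 1)).not.all) ⊓ memFormula (v 1) (v 0)).ex
    let suc : epsLang.BoundedFormula (Fin 1) 1 :=
      ((memFormula (v 1) (v 0)).imp
        ((((memFormula (v 3) (v 2)).iff ((memFormula (v 3) (v 1)) ⊔ ((v 3).bdEqual (v 1)))).all)
          ⊓ memFormula (v 2) (v 0)).ex).all
    refine ⟨((emp ⊓ suc).imp (memFormula (Language.Term.var (Sum.inl 0)) (v 0))).all, ?_⟩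
    ext x
    simp [Language.Formula.Realize, emp, suc, v, IsInductive, IsEmptySet, IsSucc, realize_memFormula,
      Fin.snoc]
  obtain ⟨b, hb⟩ := IsZF.separation _ hD w
  exact ⟨b, fun x => (hb x).trans ⟨fun h => h.2, fun h => ⟨h w hw, h⟩⟩⟩

/-- The set of natural numbers of `V`, the least inductive set. The order on it is `∈ᵥ`. -/
noncomputable def omega (V : Type u) [EpsStructure V] [IsZF V] : V := (exists_omega V).choose

theorem mem_omega (x : V) : x ∈ᵥ omega V ↔ ∀ w : V, IsInductive w → x ∈ᵥ w :=
  (exists_omega V).choose_spec x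

/-- The unordered pair `{a, b}` of `V`. -/
noncomputable def upair (a b : V) : V := (IsZF.pairing a b).choose

theorem mem_upair (a b z : V) : z ∈ᵥ upair a b ↔ z = a ∨ z = b :=
  (IsZF.pairing a b).choose_spec z

/-- The Kuratowski pair `{{a}, {a, b}}` of `V`. -/
noncomputable def pair (a b : V) : V := upair (upair a a) (upair a b)

/-- The type of elements of a set `a` of `V`. -/
@[ext] structure El (a : V) where
  val : V
  mem : val ∈ᵥ a

/-- `f` is a function with domain `a` that belongs to `V`: its graph is an element of `V`. -/
def Internal {a : V} (f : El a → V) : Prop :=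
  ∃ g : V, ∀ p, p ∈ᵥ g ↔ ∃ x, p = pair x.val (f x)

/-- `f` is a function with domain `a × b` that belongs to `V`. -/
def Internal₂ {a b : V} (f : El a → El b → V) : Prop :=
  ∃ g : V, ∀ p, p ∈ᵥ g ↔ ∃ x y, p = pair (pair x.val y.val) (f x y)

/-- `r` is a binary relation on `a` that belongs to `V`. -/
def InternalRel {a : V} (r : El a → El a → Prop) : Prop :=
  ∃ g : V, ∀ p, p ∈ᵥ g ↔ ∃ x y, r x y ∧ p = pair x.val y.val

/-- In `V` there is a bijection from `a` to `b`. -/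
def Equipotent (a b : V) : Prop :=
  ∃ f : El a → El b, Internal (fun x => (f x).val) ∧ Function.Bijective f

/-- `a` is finite in the sense of `V`: equipotent to a natural number of `V`. -/
def IsFiniteSet (a : V) : Prop := ∃ k : El (omega V), Equipotent k.val a

end Basic

/-- A field of real numbers of `V`: a complete ordered field in the sense of `V`. In ZF it exists and
is unique up to isomorphism. -/
structure Reals (V : Type u) [EpsStructure V] [IsZF V] where
  carrier : V
  field : Field (El carrier)
  order : LinearOrder (El carrier)
  ordered : IsStrictOrderedRing (El carrier)
  add_internal : Internal₂ fun x y : El carrier => (x + y).val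
  mul_internal : Internal₂ fun x y : El carrier => (x * y).val
  lt_internal : InternalRel fun x y : El carrier => x < y
  complete : ∀ s : V, (∃ x : El carrier, x.val ∈ᵥ s) →
    (∃ b : El carrier, ∀ x : El carrier, x.val ∈ᵥ s → x ≤ b) →
      ∃ l : El carrier, IsLUB {x : El carrier | x.val ∈ᵥ s} l

attribute [instance] Reals.field Reals.order Reals.ordered

/-- The type of real numbers of `V`. -/
abbrev Reals.Carrier (R : Reals V) : Type u := El R.carrier

/-- A normed real vector space of `V`. -/
structure NormedSpaceIn (R : Reals V) where
  carrier : V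
  group : AddCommGroup (El carrier)
  module : Module R.Carrier (El carrier)
  norm : El carrier → R.Carrier
  add_internal : Internal₂ fun x y : El carrier => (x + y).val
  smul_internal : Internal₂ fun (c : R.Carrier) (x : El carrier) => (c • x).val
  norm_internal : Internal fun x : El carrier => (norm x).val
  norm_eq_zero : ∀ x, norm x = 0 ↔ x = 0
  norm_smul : ∀ (c : R.Carrier) x, norm (c • x) = |c| * norm x
  norm_add_le : ∀ x y, norm (x + y) ≤ norm x + norm y

attribute [instance] NormedSpaceIn.group NormedSpaceIn.module

/-- The type of vectors of a normed space of `V`. -/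
abbrev NormedSpaceIn.Carrier {R : Reals V} (X : NormedSpaceIn R) : Type u := El X.carrier

section Analysis

variable {R : Reals V}

def IsCauchySequence (X : NormedSpaceIn R) (u : El (omega V) → X.Carrier) : Prop :=
  ∀ ε : R.Carrier, 0 < ε → ∃ N : El (omega V), ∀ m n : El (omega V),
    N.val ∈ᵥ m.val → N.val ∈ᵥ n.val → X.norm (u m - u n) < ε

def ConvergesTo (X : NormedSpaceIn R) (u : El (omega V) → X.Carrier) (l : X.Carrier) : Prop :=
  ∀ ε : R.Carrier, 0 < ε → ∃ N : El (omega V), ∀ n : El (omega V),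
    N.val ∈ᵥ n.val → X.norm (u n - l) < ε

/-- Every Cauchy sequence that belongs to `V` converges. -/
def IsBanach (X : NormedSpaceIn R) : Prop :=
  ∀ u : El (omega V) → X.Carrier, Internal (fun n => (u n).val) → IsCauchySequence X u →
    ∃ l, ConvergesTo X u l

def IsContinuousMap {X Y : NormedSpaceIn R} (T : X.Carrier → Y.Carrier) : Prop :=
  ∀ x, ∀ ε : R.Carrier, 0 < ε → ∃ δ : R.Carrier, 0 < δ ∧
    ∀ x', X.norm (x' - x) < δ → Y.norm (T x' - T x) < ε

/-- `c` is the operator norm of `T`, the supremum of `‖T x‖` over `‖x‖ ≤ 1`. -/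
def IsOpNorm {X Y : NormedSpaceIn R} (T : X.Carrier → Y.Carrier) (c : R.Carrier) : Prop :=
  IsLUB {r : R.Carrier | ∃ x, X.norm x ≤ 1 ∧ r = Y.norm (T x)} c

/-- `c` is the canonical map from the natural numbers of `V` to its real numbers. -/
def IsNatCast (R : Reals V) (c : El (omega V) → R.Carrier) : Prop :=
  Internal (fun n => (c n).val) ∧ (∀ n, IsEmptySet n.val → c n = 0) ∧
    ∀ n m, IsSucc m.val n.val → c m = c n + 1

/-- `a` is a finite set of `V` whose number of elements is at most the real number `r`. -/
def CardLE (R : Reals V) (a : V) (r : R.Carrier) : Prop :=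
  ∃ c, IsNatCast R c ∧ ∃ k : El (omega V), Equipotent k.val a ∧ c k ≤ r

end Analysis

/-- The uniform boundedness principle holds in `V`. A family of maps from `X` to `Y` indexed by a set
`A` is given as the map `A × X → Y`. -/
def UniformBoundednessPrinciple (V : Type u) [EpsStructure V] [IsZF V] : Prop :=
  ∀ (R : Reals V) (X Y : NormedSpaceIn R), IsBanach X →
    ∀ (A : V) (T : El A → X.Carrier → Y.Carrier), Internal₂ (fun α x => (T α x).val) →
      (∀ α, IsLinearMap R.Carrier (T α)) → (∀ α, IsContinuousMap (T α)) →
      (∀ x, ∃ C : R.Carrier, ∀ α, Y.norm (T α x) ≤ C) →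
        ∃ C : R.Carrier, ∀ α, ∃ c, IsOpNorm (T α) c ∧ c ≤ C

/-- The axiom of partial countable asymptotic choice holds in `V`. -/
def PartialCountableAsymptoticChoice (V : Type u) [EpsStructure V] [IsZF V] : Prop :=
  ∀ (R : Reals V) (S : El (omega V) → V), Internal S →
    (∀ n, IsFiniteSet (S n)) → (∀ n, ∃ z, z ∈ᵥ S n) →
    ∀ lam : El (omega V) → R.Carrier, Internal (fun n => (lam n).val) →
      (∀ n, 0 < lam n) → (¬ ∃ C : R.Carrier, ∀ n, lam n ≤ C) →
        ∃ I : V, SubsetOf I (omega V) ∧ ¬ IsFiniteSet I ∧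
          ∃ M : El I → V, Internal M ∧ ∃ C : R.Carrier, 0 < C ∧
            ∀ (i : El I) (n : El (omega V)), i.val = n.val →
              SubsetOf (M i) (S n) ∧ (∃ z, z ∈ᵥ M i) ∧ CardLE R (M i) (C * lam n)

end ZFModel

set_option linter.unusedSectionVars false

/-! Up to equivalence of norms, the proof applies uniform boundedness to the `ℓ^∞`-sum of the spaces
`ℓ¹(S n)`. The functionals `f ↦ lam n * f_n({s})`, for `s ∈ S n`, are unbounded on the unit ball:
the unit mass at any point of `S n` takes the value `lam n`. So a single bounded `f` makes the
numbers `lam n * f_n({s})` unbounded above. Let `M n` consist of those `s ∈ S n` with `lam n *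
f_n({s}) ≥ 1`, and let `K` bound `f`. Adding up masses gives `|M n| ≤ lam n * f_n(M n) ≤ K * lam n`.
Let `I` be the set of `n` with `M n` nonempty. If `I` were finite, `lam` would be bounded on `I` by
some `C`, and then no value `lam n * f_n({s})` could exceed `max 1 (C * K)`.

To avoid finite sums inside the model, an element of `ℓ¹(S n)` is represented by the additive set
function it induces on the subsets of `U = ⋃ S n`. The norm is the supremum of absolute values over
all `n` and all subsets. Completeness needs no choice, since the limit of a Cauchy sequence is given
pointwise by an explicit supremum.

The other half of the work is to show that every object constructed belongs to the model. For this,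
definability of functions and predicates is made compositional (`DFun`), so that separation and
replacement apply. Choice in the ambient logic does no harm: wherever a function built with it has
to be internal, its values are pinned down by a definable condition. The main lemmas are
`exists_normedSpace`, `isBanach_of_isClosed`, `UniformBoundednessPrinciple.exists_unbounded`,
`UniformBoundednessPrinciple.exists_charge` and `exists_equipotent_le`. -/

namespace ZFModel

open FirstOrder

/-! ### First-order definability with parameters -/

section Base

variable {V : Type u} [EpsStructure V]

/-- A predicate on sequences of elements of `V` that is first-order definable with parameters. -/
def Dfn (P : (ℕ → V) → Prop) : Prop := (Set.univ : Set V).Definable epsLang {v | P v}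

theorem Dfn.congr {P Q : (ℕ → V) → Prop} (h : Dfn P) (hPQ : ∀ v, Q v ↔ P v) : Dfn Q := by
  have : Q = P := funext fun v => propext (hPQ v)
  exact this ▸ h

theorem Dfn.mem (i j : ℕ) : Dfn fun v : ℕ → V => v i ∈ᵥ v j := by
  refine Set.Definable.mono (Set.empty_definable_iff.2 ?_) (Set.empty_subset _)
  refine ⟨memFormula (Language.Term.var (Sum.inl i)) (Language.Term.var (Sum.inl j)), ?_⟩
  ext v
  simp [Language.Formula.Realize, realize_memFormula]

theorem Dfn.eq (i j : ℕ) : Dfn fun v : ℕ → V => v i = v j := by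
  refine Set.Definable.mono (Set.empty_definable_iff.2 ?_) (Set.empty_subset _)
  refine ⟨(Language.Term.var i).equal (Language.Term.var j), ?_⟩
  ext v
  simp

theorem Dfn.eq_const (i : ℕ) (c : V) : Dfn fun v : ℕ → V => v i = c := by
  refine Set.definable_iff_exists_formula_sum.2 ?_
  refine ⟨(Language.Term.var (Sum.inr i)).equal (Language.Term.var (Sum.inl ⟨c, trivial⟩)), ?_⟩
  ext v
  simp

theorem Dfn.and {P Q : (ℕ → V) → Prop} (hP : Dfn P) (hQ : Dfn Q) : Dfn fun v => P v ∧ Q v :=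
  Set.Definable.inter hP hQ

theorem Dfn.or {P Q : (ℕ → V) → Prop} (hP : Dfn P) (hQ : Dfn Q) : Dfn fun v => P v ∨ Q v :=
  Set.Definable.union hP hQ

theorem Dfn.not {P : (ℕ → V) → Prop} (hP : Dfn P) : Dfn fun v => ¬ P v :=
  Set.Definable.compl hP

theorem Dfn.imp {P Q : (ℕ → V) → Prop} (hP : Dfn P) (hQ : Dfn Q) : Dfn fun v => P v → Q v :=
  (hP.not.or hQ).congr fun _ => imp_iff_not_or

theorem Dfn.iff {P Q : (ℕ → V) → Prop} (hP : Dfn P) (hQ : Dfn Q) : Dfn fun v => (P v ↔ Q v) :=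
  ((hP.imp hQ).and (hQ.imp hP)).congr fun _ => iff_iff_implies_and_implies

theorem Dfn.subst {P : (ℕ → V) → Prop} (hP : Dfn P) (σ : ℕ → ℕ) : Dfn fun v => P fun i => v (σ i) :=
  Set.Definable.preimage_comp σ hP

/-- Projections of definable sets are definable. Variables follow the de Bruijn convention: the
bound variable gets index 0 and the free ones shift up by one. -/
theorem Dfn.ex {P : (ℕ → V) → V → Prop} (h : Dfn fun v => P (fun i => v (i + 1)) (v 0)) :
    Dfn fun v => ∃ x, P v x := by
  have h1 := (Set.Definable.preimage_comp
    (fun n : ℕ => Nat.casesOn n (Sum.inr (0 : Fin 1)) Sum.inl : ℕ → ℕ ⊕ Fin 1) h)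
  have h2 := h1.image_comp_sumInl_fin 1
  refine cast (congrArg _ ?_) h2
  ext v
  constructor
  · rintro ⟨w, hw, rfl⟩
    exact ⟨w (Sum.inr 0), hw⟩
  · rintro ⟨x, hx⟩
    exact ⟨Sum.elim v fun _ => x, hx, rfl⟩

theorem Dfn.all {P : (ℕ → V) → V → Prop} (h : Dfn fun v => P (fun i => v (i + 1)) (v 0)) :
    Dfn fun v => ∀ x, P v x :=
  (Dfn.not (Dfn.ex (P := fun v x => ¬ P v x) h.not)).congr fun v => by simp

theorem Dfn.definable₁ {P : V → Prop} (h : Dfn fun v => P (v 0)) :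
    (Set.univ : Set V).Definable₁ epsLang {x | P x} :=
  Set.Definable.preimage_comp (fun _ : ℕ => (0 : Fin 1)) h

theorem Dfn.definable₂ {P : V → V → Prop} (h : Dfn fun v => P (v 0) (v 1)) :
    (Set.univ : Set V).Definable₂ epsLang {p | P p.1 p.2} :=
  Set.Definable.preimage_comp (s := {v : ℕ → V | P (v 0) (v 1)})
    (fun n => if n = 0 then 0 else 1 : ℕ → Fin 2) h

end Base

/-! ### Extensionality, ordered pairs and the empty set -/

section Sets

variable {V : Type u} [EpsStructure V] [IsZF V]

theorem exists_sep {P : V → Prop} (h : Dfn fun v => P (v 0)) (a : V) :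
    ∃ b, ∀ z, z ∈ᵥ b ↔ z ∈ᵥ a ∧ P z :=
  IsZF.separation _ h.definable₁ a

theorem ext_iff {a b : V} : a = b ↔ ∀ z, z ∈ᵥ a ↔ z ∈ᵥ b :=
  ⟨fun h _ => h ▸ Iff.rfl, IsZF.extensionality a b⟩

theorem upair_inj {a b c d : V} (h : upair a b = upair c d) : a = c ∧ b = d ∨ a = d ∧ b = c := by
  have h' : ∀ z, z = a ∨ z = b ↔ z = c ∨ z = d := fun z => by
    rw [← mem_upair, ← mem_upair, h]
  have ha := (h' a).1 (Or.inl rfl)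
  have hb := (h' b).1 (Or.inr rfl)
  have hc := (h' c).2 (Or.inl rfl)
  have hd := (h' d).2 (Or.inr rfl)
  grind

theorem pair_inj {a b c d : V} : pair a b = pair c d ↔ a = c ∧ b = d := by
  refine ⟨fun h => ?_, fun h => by rw [h.1, h.2]⟩
  rcases upair_inj h with ⟨h1, h2⟩ | ⟨h1, h2⟩
  · have e1 := upair_inj h1
    have e2 := upair_inj h2
    grind
  · have e1 := upair_inj h1
    have e2 := upair_inj h2
    grind

theorem Dfn.eq_upair (i j k : ℕ) : Dfn fun v : ℕ → V => v i = upair (v j) (v k) := by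
  refine Dfn.congr (P := fun v => ∀ z, z ∈ᵥ v i ↔ z = v j ∨ z = v k)
    (.all (.iff (.mem _ _) (.or (.eq _ _) (.eq _ _)))) fun v => ?_
  simp [ext_iff, mem_upair]

theorem Dfn.eq_pair (i j k : ℕ) : Dfn fun v : ℕ → V => v i = pair (v j) (v k) := by
  refine Dfn.congr
    (P := fun v => ∃ x, ∃ y, x = upair (v j) (v j) ∧ y = upair (v j) (v k) ∧ v i = upair x y)
    (.ex (.ex (.and (.eq_upair _ _ _) (.and (.eq_upair _ _ _) (.eq_upair _ _ _))))) fun v => ?_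
  simp [pair]

theorem exists_empty (V : Type u) [EpsStructure V] [IsZF V] : ∃ e : V, IsEmptySet e := by
  obtain ⟨w, ⟨e, he, -⟩, -⟩ := IsZF.infinity (V := V)
  exact ⟨e, he⟩

noncomputable def emp (V : Type u) [EpsStructure V] [IsZF V] : V := (exists_empty V).choose

theorem not_mem_emp (z : V) : ¬ z ∈ᵥ emp V := (exists_empty V).choose_spec z

theorem isEmptySet_iff {e : V} : IsEmptySet e ↔ e = emp V := by
  refine ⟨fun h => ext_iff.2 fun z => iff_of_false (h z) (not_mem_emp z), fun h => h ▸ not_mem_emp⟩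

end Sets

/-! ### Coded types and definable functions between them -/

/-- A type whose elements are coded by the elements of a definable class of `V`. -/
class Coded (V : Type u) [EpsStructure V] (E : Type*) where
  code : E → V
  code_inj : Function.Injective code
  range_dfn : Dfn fun v : ℕ → V => ∃ e, v 0 = code e

section Coding

variable {V : Type u} [EpsStructure V] [IsZF V]

open Coded

instance instCodedSelf : Coded V V where
  code := id
  code_inj := Function.injective_id
  range_dfn := (Dfn.eq 0 0).congr fun _ => by simp

instance instCodedEl (a : V) : Coded V (El a) where
  code := El.val
  code_inj := fun _ _ h => El.ext h
  range_dfn := (Dfn.ex (.and (.eq_const 0 a) (.mem 1 0))).congr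
    (P := fun v => ∃ b, b = a ∧ v 0 ∈ᵥ b) fun v => by
      simp only [exists_eq_left]
      exact ⟨fun ⟨e, he⟩ => he ▸ e.mem, fun h => ⟨⟨_, h⟩, rfl⟩⟩

noncomputable instance instCodedProd {E F : Type*} [Coded V E] [Coded V F] : Coded V (E × F) where
  code p := pair (code p.1) (code p.2)
  code_inj := fun p q h => by
    have := pair_inj.1 h
    exact Prod.ext (code_inj this.1) (code_inj this.2)
  range_dfn := by
    refine (Dfn.ex (.ex (.and (.eq_pair 2 0 1) (.and ((range_dfn (E := E)).subst fun _ => 0)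
      ((range_dfn (E := F)).subst fun _ => 1))))).congr
      (P := fun v => ∃ x y, v 0 = pair y x ∧ (∃ e : E, y = code e) ∧ ∃ f : F, x = code f) fun v => ?_
    constructor
    · rintro ⟨p, hp⟩
      exact ⟨_, _, hp, ⟨_, rfl⟩, ⟨_, rfl⟩⟩
    · rintro ⟨x, y, h, ⟨e, rfl⟩, ⟨f, rfl⟩⟩
      exact ⟨(e, f), h⟩

-- With the truth values coded by two distinct sets, a definable predicate is just a definable
-- function into `Prop`, so predicates and functions share one calculus.
open Classical in
noncomputable instance instCodedProp : Coded V Prop where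
  code p := if p then upair (emp V) (emp V) else emp V
  code_inj := fun p q h => by
    have key : emp V ≠ upair (emp V) (emp V) := fun h => by
      have := (ext_iff.1 h (emp V)).2 ((mem_upair _ _ _).2 (Or.inl rfl))
      exact not_mem_emp _ this
    by_cases hp : p <;> by_cases hq : q <;> simp_all
  range_dfn := ((Dfn.eq_const 0 (upair (emp V) (emp V))).or (.eq_const 0 (emp V))).congr fun v => by
    constructor
    · rintro ⟨p, hp⟩
      by_cases h : p <;> simp_all
    · rintro (h | h)
      · exact ⟨True, by simpa using h⟩
      · exact ⟨False, by simpa using h⟩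

variable {E F G H : Type*} [Coded V E] [Coded V F] [Coded V G] [Coded V H]

variable (V) in
/-- A function between coded types whose graph is a definable class. -/
@[fun_prop]
def DFun (f : E → F) : Prop :=
  Dfn fun v : ℕ → V => ∃ e, v 0 = code e ∧ v 1 = code (f e)

theorem DFun.at {f : E → F} (hf : DFun V f) (i j : ℕ) :
    Dfn fun v : ℕ → V => ∃ e, v i = code e ∧ v j = code (f e) :=
  hf.subst fun n => Nat.casesOn n i fun _ => j

theorem range_dfn_at (V : Type u) [EpsStructure V] [IsZF V] (E : Type*) [Coded V E] (i : ℕ) :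
    Dfn fun v : ℕ → V => ∃ e : E, v i = code e :=
  (range_dfn (V := V) (E := E)).subst fun _ => i

theorem DFun.pred {P : E → Prop} (h : DFun V P) (i : ℕ) :
    Dfn fun v : ℕ → V => ∃ e, v i = code e ∧ P e := by
  refine (Dfn.ex (.and (.eq_const 0 (code True)) (h.at (i + 1) 0))).congr
    (P := fun v => ∃ x, x = code True ∧ ∃ e, v i = code e ∧ x = code (P e)) fun v => ?_
  simp only [exists_eq_left, code_inj.eq_iff, eq_comm (a := True), eq_iff_iff, iff_true]

theorem DFun.of_pred {P : E → Prop} (h : Dfn fun v : ℕ → V => ∃ e, v 0 = code e ∧ P e) :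
    DFun V P := by
  have key (p : Prop) : Dfn fun v : ℕ → V => v 1 = code p := .eq_const 1 _
  refine Dfn.congr ((h.and (key True)).or ((h.not.and (range_dfn_at V E 0)).and (key False)))
    fun v => ?_
  constructor
  · rintro ⟨e, he, hv⟩
    by_cases hP : P e
    · exact Or.inl ⟨⟨e, he, hP⟩, by rw [hv]; simp [hP]⟩
    · refine Or.inr ⟨⟨?_, e, he⟩, by rw [hv]; simp [hP]⟩
      rintro ⟨e', he', hP'⟩
      exact hP (code_inj (he.symm.trans he') ▸ hP')
  · rintro (⟨⟨e, he, hP⟩, hv⟩ | ⟨⟨h1, e, he⟩, hv⟩)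
    · exact ⟨e, he, by rw [hv]; simp [hP]⟩
    · have hP : ¬ P e := fun hP => h1 ⟨e, he, hP⟩
      exact ⟨e, he, by rw [hv]; simp [hP]⟩

theorem DFun.congr {f g : E → F} (h : DFun V f) (hfg : ∀ e, g e = f e) : DFun V g := by
  have : g = f := funext hfg
  exact this ▸ h

@[fun_prop]
theorem DFun.id : DFun V fun e : E => e :=
  ((range_dfn_at V E 0).and (.eq 1 0)).congr fun v => by
    constructor
    · rintro ⟨e, h, h'⟩
      exact ⟨⟨e, h⟩, h'.trans h.symm⟩
    · rintro ⟨⟨e, h⟩, h'⟩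
      exact ⟨e, h, h'.trans h⟩

@[fun_prop]
theorem DFun.const (c : F) : DFun V fun _ : E => c :=
  ((range_dfn_at V E 0).and (.eq_const 1 (code c))).congr fun v => by
    constructor
    · rintro ⟨e, h, h'⟩
      exact ⟨⟨e, h⟩, h'⟩
    · rintro ⟨⟨e, h⟩, h'⟩
      exact ⟨e, h, h'⟩

@[fun_prop]
theorem DFun.comp {g : F → G} {f : E → F} (hg : DFun V g) (hf : DFun V f) :
    DFun V fun e => g (f e) := by
  refine (Dfn.ex (.and (hf.at 1 0) (hg.at 0 2))).congr
    (P := fun v => ∃ y, (∃ e, v 0 = code e ∧ y = code (f e)) ∧ ∃ z, y = code z ∧ v 1 = code (g z))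
    fun v => ?_
  constructor
  · rintro ⟨e, h, h'⟩
    exact ⟨_, ⟨e, h, rfl⟩, _, rfl, h'⟩
  · rintro ⟨y, ⟨e, h, rfl⟩, z, hz, h'⟩
    exact ⟨e, h, by rw [h', ← code_inj hz]⟩

@[fun_prop]
theorem DFun.prodMk {f : E → F} {g : E → G} (hf : DFun V f) (hg : DFun V g) :
    DFun V fun e => (f e, g e) := by
  refine (Dfn.ex (.ex (.and (.eq_pair 3 0 1) (.and (hf.at 2 0) (hg.at 2 1))))).congr
    (P := fun v => ∃ y x, v 1 = pair x y ∧ (∃ e, v 0 = code e ∧ x = code (f e)) ∧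
      ∃ e, v 0 = code e ∧ y = code (g e)) fun v => ?_
  constructor
  · rintro ⟨e, h, h'⟩
    exact ⟨_, _, h', ⟨e, h, rfl⟩, e, h, rfl⟩
  · rintro ⟨y, x, h, ⟨e, he, rfl⟩, e', he', rfl⟩
    obtain rfl := code_inj (he.symm.trans he')
    exact ⟨e, he, h⟩

theorem DFun.fst_prod : DFun V fun p : E × F => p.1 := by
  refine (Dfn.ex (.and (.eq_pair 1 2 0) (.and (range_dfn_at V E 2) (range_dfn_at V F 0)))).congr
    (P := fun v => ∃ y, v 0 = pair (v 1) y ∧ (∃ e : E, v 1 = code e) ∧ ∃ f : F, y = code f)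
    fun v => ?_
  constructor
  · rintro ⟨p, h, h'⟩
    exact ⟨code p.2, by rw [h, h']; rfl, ⟨_, h'⟩, ⟨_, rfl⟩⟩
  · rintro ⟨y, h, ⟨e, he⟩, f, rfl⟩
    exact ⟨(e, f), by rw [h, he]; rfl, he⟩

theorem DFun.snd_prod : DFun V fun p : E × F => p.2 := by
  refine (Dfn.ex (.and (.eq_pair 1 0 2) (.and (range_dfn_at V F 2) (range_dfn_at V E 0)))).congr
    (P := fun v => ∃ y, v 0 = pair y (v 1) ∧ (∃ e : F, v 1 = code e) ∧ ∃ f : E, y = code f)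
    fun v => ?_
  constructor
  · rintro ⟨p, h, h'⟩
    exact ⟨code p.1, by rw [h, h']; rfl, ⟨_, h'⟩, ⟨_, rfl⟩⟩
  · rintro ⟨y, h, ⟨e, he⟩, f, rfl⟩
    exact ⟨(f, e), by rw [h, he]; rfl, he⟩

@[fun_prop]
theorem DFun.fst {f : E → F × G} (hf : DFun V f) : DFun V fun e => (f e).1 :=
  DFun.fst_prod.comp hf

@[fun_prop]
theorem DFun.snd {f : E → F × G} (hf : DFun V f) : DFun V fun e => (f e).2 :=
  DFun.snd_prod.comp hf

@[fun_prop]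
theorem DFun.not {P : E → Prop} (hP : DFun V P) : DFun V fun e => ¬ P e := by
  refine .of_pred (((hP.pred 0).not.and (range_dfn_at V E 0)).congr fun v => ?_)
  constructor
  · rintro ⟨e, he, h⟩
    exact ⟨fun ⟨e', he', h'⟩ => h (code_inj (he.symm.trans he') ▸ h'), e, he⟩
  · rintro ⟨h, e, he⟩
    exact ⟨e, he, fun h' => h ⟨e, he, h'⟩⟩

@[fun_prop]
theorem DFun.or {P Q : E → Prop} (hP : DFun V P) (hQ : DFun V Q) : DFun V fun e => P e ∨ Q e := by
  refine .of_pred (((hP.pred 0).or (hQ.pred 0)).congr fun v => ?_)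
  simp only [and_or_left, exists_or]

@[fun_prop]
theorem DFun.and {P Q : E → Prop} (hP : DFun V P) (hQ : DFun V Q) : DFun V fun e => P e ∧ Q e :=
  (hP.not.or hQ.not).not.congr fun e => by simp [not_or]

theorem DFun.imp {P Q : E → Prop} (hP : DFun V P) (hQ : DFun V Q) : DFun V fun e => P e → Q e :=
  (hP.not.or hQ).congr fun _ => propext imp_iff_not_or

@[fun_prop]
theorem DFun.iff {P Q : E → Prop} (hP : DFun V P) (hQ : DFun V Q) : DFun V fun e => (P e ↔ Q e) :=
  ((hP.imp hQ).and (hQ.imp hP)).congr fun _ => propext iff_iff_implies_and_implies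

@[fun_prop]
theorem DFun.ex {P : E → F → Prop} (h : DFun V fun p : E × F => P p.1 p.2) :
    DFun V fun e => ∃ y, P e y := by
  refine .of_pred ((Dfn.ex (.ex (.and (.eq_pair 0 2 1) (h.pred 0)))).congr
    (P := fun v => ∃ y q, q = pair (v 0) y ∧ ∃ p : E × F, q = code p ∧ P p.1 p.2) fun v => ?_)
  constructor
  · rintro ⟨e, he, y, h⟩
    exact ⟨code y, _, rfl, (e, y), by rw [he]; rfl, h⟩
  · rintro ⟨y, q, rfl, p, hq, hp⟩
    exact ⟨p.1, (pair_inj.1 hq).1, p.2, hp⟩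

theorem DFun.all {P : E → F → Prop} (h : DFun V fun p : E × F => P p.1 p.2) :
    DFun V fun e => ∀ y, P e y :=
  (DFun.ex (P := fun e y => ¬ P e y) h.not).not.congr fun e => by simp

@[fun_prop]
theorem DFun.eq {f g : E → F} (hf : DFun V f) (hg : DFun V g) : DFun V fun e => f e = g e := by
  refine .of_pred ((Dfn.ex (.and (hf.at 1 0) (hg.at 1 0))).congr
    (P := fun v => ∃ y, (∃ e, v 0 = code e ∧ y = code (f e)) ∧ ∃ e, v 0 = code e ∧ y = code (g e))
    fun v => ?_)
  constructor
  · rintro ⟨e, he, h⟩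
    exact ⟨_, ⟨e, he, rfl⟩, e, he, by rw [h]⟩
  · rintro ⟨y, ⟨e, he, rfl⟩, e', he', h⟩
    obtain rfl := code_inj (he.symm.trans he')
    exact ⟨e, he, code_inj h⟩

@[fun_prop]
theorem DFun.mem {f g : E → V} (hf : DFun V f) (hg : DFun V g) :
    DFun V fun e => f e ∈ᵥ g e := by
  refine .of_pred ((Dfn.ex (.ex (.and (hf.at 2 1) (.and (hg.at 2 0) (.mem 1 0))))).congr
    (P := fun v => ∃ y x, (∃ e, v 0 = code e ∧ y = code (f e)) ∧ (∃ e, v 0 = code e ∧ x = code (g e))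
      ∧ y ∈ᵥ x) fun v => ?_)
  constructor
  · rintro ⟨e, he, h⟩
    exact ⟨_, _, ⟨e, he, rfl⟩, ⟨e, he, rfl⟩, h⟩
  · rintro ⟨y, x, ⟨e, he, rfl⟩, ⟨e', he', rfl⟩, h⟩
    obtain rfl := code_inj (he.symm.trans he')
    exact ⟨e, he, h⟩

theorem DFun.of_graph {f : E → F} (h : DFun V fun p : E × F => p.2 = f p.1) : DFun V f := by
  refine ((Dfn.ex (.and (.eq_pair 0 1 2) (h.pred 0)))).congr
    (P := fun v => ∃ q, q = pair (v 0) (v 1) ∧ ∃ p : E × F, q = code p ∧ p.2 = f p.1) fun v => ?_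
  constructor
  · rintro ⟨e, he, h⟩
    exact ⟨_, rfl, (e, f e), by rw [he, h]; rfl, rfl⟩
  · rintro ⟨q, rfl, p, hp, h⟩
    exact ⟨p.1, (pair_inj.1 hp).1, by rw [← h]; exact (pair_inj.1 hp).2⟩

/-- The standard way to handle a function obtained by ambient choice: it is definable as soon as its
value is the unique solution of a definable condition. -/
theorem DFun.of_iff {f : E → F} {Q : E → F → Prop} (h : DFun V fun p : E × F => Q p.1 p.2)
    (hQ : ∀ e y, y = f e ↔ Q e y) : DFun V f :=
  .of_graph (h.congr fun p => propext (hQ p.1 p.2))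

theorem DFun.of_mem {f : E → V} (h : DFun V fun p : E × V => p.2 ∈ᵥ f p.1) : DFun V f := by
  have h' := h.comp (f := fun p : (E × V) × V => (p.1.1, p.2)) (by fun_prop)
  exact .of_iff (Q := fun e y => ∀ z, z ∈ᵥ y ↔ z ∈ᵥ f e) (.all (.iff (by fun_prop) h'))
    fun _ _ => ext_iff

@[fun_prop]
theorem DFun.val {a : V} {f : E → El a} (hf : DFun V f) : DFun V fun e => (f e).val := hf

theorem DFun.of_val {a : V} {f : E → El a} (hf : DFun V fun e => (f e).val) : DFun V f := hf

@[fun_prop]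
theorem DFun.ite {P : E → Prop} [DecidablePred P] {f g : E → F} (hP : DFun V P) (hf : DFun V f)
    (hg : DFun V g) : DFun V fun e => if P e then f e else g e :=
  .of_iff (Q := fun e y => (P e ∧ y = f e) ∨ (¬ P e ∧ y = g e)) (by fun_prop) fun e y => by
    by_cases h : P e <;> simp [h]

@[fun_prop]
theorem DFun.pair {f g : E → V} (hf : DFun V f) (hg : DFun V g) :
    DFun V fun e => pair (f e) (g e) :=
  hf.prodMk hg

end Coding

/-! ### Replacement, products, natural numbers and function sets -/

section SetTheory

variable {V : Type u} [EpsStructure V] [IsZF V]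

/-- Replacement for definable functions. Applied to `x ↦ (x, f x)` it shows that a definable
function on a set has its graph in the model. -/
theorem exists_image {a : V} {f : El a → V} (hf : DFun V f) : ∃ b, ∀ z, z ∈ᵥ b ↔ ∃ x, z = f x := by
  obtain ⟨b, hb⟩ := IsZF.replacement
    {p : V × V | ∃ x : El a, p.1 = x.val ∧ p.2 = f x} 
    (Dfn.definable₂ (P := fun x y => ∃ e : El a, x = e.val ∧ y = f e) hf) a (by
      rintro x - y y' ⟨e, he, h⟩ ⟨e', he', h'⟩
      have : e = e' := El.ext (he.symm.trans he')
      subst this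
      exact h.trans h'.symm)
  refine ⟨b, fun z => (hb z).trans ⟨?_, ?_⟩⟩
  · rintro ⟨x, -, e, -, h⟩
    exact ⟨e, h⟩
  · rintro ⟨x, h⟩
    exact ⟨x.val, x.mem, x, rfl, h⟩

theorem exists_subset {a : V} {P : El a → Prop} (h : DFun V P) :
    ∃ b, ∀ z, z ∈ᵥ b ↔ ∃ hz : z ∈ᵥ a, P ⟨z, hz⟩ := by
  obtain ⟨b, hb⟩ := exists_sep (P := fun z => ∃ e : El a, z = e.val ∧ P e) (h.pred 0) a
  refine ⟨b, fun z => (hb z).trans ⟨?_, ?_⟩⟩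
  · rintro ⟨hz, e, rfl, h⟩
    exact ⟨hz, h⟩
  · rintro ⟨hz, h⟩
    exact ⟨hz, ⟨z, hz⟩, rfl, h⟩

theorem exists_sep_of_dFun {P : V → Prop} (h : DFun V P) (a : V) :
    ∃ b, ∀ z, z ∈ᵥ b ↔ z ∈ᵥ a ∧ P z :=
  exists_sep ((h.pred 0).congr fun _ => ⟨fun h => ⟨_, rfl, h⟩, fun ⟨_, h, h'⟩ => h ▸ h'⟩) a

theorem Internal.dFun {a : V} {f : El a → V} (h : Internal f) : DFun V f := by
  obtain ⟨g, hg⟩ := h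
  refine .of_iff (Q := fun e y => pair e.val y ∈ᵥ g) (by fun_prop) fun e y => ?_
  rw [hg]
  constructor
  · rintro rfl
    exact ⟨e, rfl⟩
  · rintro ⟨x, hx⟩
    obtain ⟨h1, h2⟩ := pair_inj.1 hx
    rw [h2, El.ext h1]

theorem DFun.internal {a : V} {f : El a → V} (h : DFun V f) : Internal f :=
  exists_image (f := fun x => ZFModel.pair x.val (f x)) (by fun_prop)

theorem Internal₂.dFun {a b : V} {f : El a → El b → V} (h : Internal₂ f) :
    DFun V fun p : El a × El b => f p.1 p.2 := by
  obtain ⟨g, hg⟩ := h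
  refine .of_iff (Q := fun e y => pair (pair e.1.val e.2.val) y ∈ᵥ g) (by fun_prop) fun e y => ?_
  rw [hg]
  constructor
  · rintro rfl
    exact ⟨e.1, e.2, rfl⟩
  · rintro ⟨x, x', hx⟩
    obtain ⟨h1, h2⟩ := pair_inj.1 hx
    obtain ⟨h3, h4⟩ := pair_inj.1 h1
    rw [h2, El.ext h3, El.ext h4]

theorem InternalRel.dFun {a : V} {r : El a → El a → Prop} (h : InternalRel r) :
    DFun V fun p : El a × El a => r p.1 p.2 := by
  obtain ⟨g, hg⟩ := h
  refine DFun.congr (f := fun p : El a × El a => pair p.1.val p.2.val ∈ᵥ g) (by fun_prop) fun p => ?_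
  refine propext ?_
  rw [hg]
  constructor
  · intro h
    exact ⟨_, _, h, rfl⟩
  · rintro ⟨x, x', h, hx⟩
    obtain ⟨h3, h4⟩ := pair_inj.1 hx
    rwa [El.ext h3, El.ext h4]

/-- The rows `{x} × b` exist by replacement, a second replacement collects them, and their union is
the product. -/
theorem exists_prod (a b : V) :
    ∃ c, ∀ z, z ∈ᵥ c ↔ ∃ (x : El a) (y : El b), z = pair x.val y.val := by
  have h (x : V) : ∃ r, ∀ z, z ∈ᵥ r ↔ ∃ y : El b, z = pair x y.val :=
    exists_image (f := fun y : El b => pair x y.val) (by fun_prop)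
  choose row hrow using h
  have hd : DFun V fun x : El a => row x.val :=
    .of_mem (by simp only [hrow]; fun_prop)
  obtain ⟨r, hr⟩ := exists_image hd
  obtain ⟨c, hc⟩ := IsZF.union r
  refine ⟨c, fun z => (hc z).trans ⟨?_, ?_⟩⟩
  · rintro ⟨y, hy, hz⟩
    obtain ⟨x, rfl⟩ := (hr y).1 hy
    exact ⟨x, (hrow _ _).1 hz⟩
  · rintro ⟨x, y, rfl⟩
    exact ⟨_, (hr _).2 ⟨x, rfl⟩, (hrow _ _).2 ⟨y, rfl⟩⟩

/-- The cartesian product in `V`. -/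
noncomputable def prod (a b : V) : V := (exists_prod a b).choose

theorem mem_prod {a b z : V} : z ∈ᵥ prod a b ↔ ∃ (x : El a) (y : El b), z = pair x.val y.val :=
  (exists_prod a b).choose_spec z

namespace El

variable {a b : V}

noncomputable def mkPair (x : El a) (y : El b) : El (prod a b) :=
  ⟨pair x.val y.val, mem_prod.2 ⟨x, y, rfl⟩⟩

noncomputable def fst (d : El (prod a b)) : El a := (mem_prod.1 d.mem).choose

noncomputable def snd (d : El (prod a b)) : El b := (mem_prod.1 d.mem).choose_spec.choose

theorem val_eq (d : El (prod a b)) : d.val = pair d.fst.val d.snd.val :=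
  (mem_prod.1 d.mem).choose_spec.choose_spec

theorem mkPair_eta (d : El (prod a b)) : mkPair d.fst d.snd = d := El.ext d.val_eq.symm

@[simp]
theorem fst_mkPair (x : El a) (y : El b) : (mkPair x y).fst = x :=
  El.ext (pair_inj.1 (mkPair x y).val_eq.symm).1

@[simp]
theorem snd_mkPair (x : El a) (y : El b) : (mkPair x y).snd = y :=
  El.ext (pair_inj.1 (mkPair x y).val_eq.symm).2

end El

variable {E F G : Type*} [Coded V E] [Coded V F] [Coded V G]

@[fun_prop]
theorem DFun.mkPair {a b : V} {f : E → El a} {g : E → El b} (hf : DFun V f) (hg : DFun V g) :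
    DFun V fun e => El.mkPair (f e) (g e) :=
  DFun.of_val (hf.val.pair hg.val)

@[fun_prop]
theorem DFun.elFst {a b : V} {f : E → El (prod a b)} (hf : DFun V f) : DFun V fun e => (f e).fst :=
  .of_iff (Q := fun e x => ∃ y, f e = El.mkPair x y) (by fun_prop) fun e x => by
    constructor
    · rintro rfl
      exact ⟨_, (El.mkPair_eta _).symm⟩
    · rintro ⟨y, h⟩
      simp [h]

@[fun_prop]
theorem DFun.elSnd {a b : V} {f : E → El (prod a b)} (hf : DFun V f) : DFun V fun e => (f e).snd :=
  .of_iff (Q := fun e y => ∃ x, f e = El.mkPair x y) (by fun_prop) fun e x => by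
    constructor
    · rintro rfl
      exact ⟨_, (El.mkPair_eta _).symm⟩
    · rintro ⟨y, h⟩
      simp [h]

theorem DFun.internal₂ {a b : V} {f : El a → El b → V}
    (h : DFun V fun p : El a × El b => f p.1 p.2) : Internal₂ f := by
  obtain ⟨g, hg⟩ := exists_image
    (f := fun d : El (prod a b) => ZFModel.pair (ZFModel.pair d.fst.val d.snd.val) (f d.fst d.snd))
    (by
      have := h.comp (f := fun d : El (prod a b) => (d.fst, d.snd)) (by fun_prop)
      fun_prop)
  refine ⟨g, fun p => (hg p).trans ⟨?_, ?_⟩⟩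
  · rintro ⟨x, h⟩
    exact ⟨_, _, h⟩
  · rintro ⟨x, y, h⟩
    exact ⟨El.mkPair x y, by simpa using h⟩

theorem exists_insertV (a s : V) : ∃ b, ∀ z, z ∈ᵥ b ↔ z ∈ᵥ a ∨ z = s := by
  obtain ⟨b, hb⟩ := IsZF.union (upair a (upair s s))
  refine ⟨b, fun z => (hb z).trans ?_⟩
  simp [mem_upair]

/-- The set `a ∪ {s}`. -/
noncomputable def insertV (a s : V) : V := (exists_insertV a s).choose

@[simp]
theorem mem_insertV {a s z : V} : z ∈ᵥ insertV a s ↔ z ∈ᵥ a ∨ z = s :=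
  (exists_insertV a s).choose_spec z

@[fun_prop]
theorem DFun.insertV {f g : E → V} (hf : DFun V f) (hg : DFun V g) :
    DFun V fun e => insertV (f e) (g e) :=
  .of_mem (by simp only [mem_insertV]; fun_prop)

theorem not_mem_self (a : V) : ¬ a ∈ᵥ a := by
  intro h
  obtain ⟨y, hy, h'⟩ := IsZF.foundation (upair a a) ⟨a, (mem_upair _ _ _).2 (Or.inl rfl)⟩
  obtain rfl : y = a := by simpa using (mem_upair _ _ _).1 hy
  exact h' y hy h

theorem isSucc_iff {s x : V} : IsSucc s x ↔ s = insertV x x := by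
  rw [ext_iff]; simp [IsSucc]

theorem isInductive_iff {w : V} :
    IsInductive w ↔ emp V ∈ᵥ w ∧ ∀ x, x ∈ᵥ w → insertV x x ∈ᵥ w := by
  simp [IsInductive, isEmptySet_iff, isSucc_iff]

theorem isInductive_omega : IsInductive (omega V) := by
  refine isInductive_iff.2 ⟨(mem_omega _).2 fun w hw => (isInductive_iff.1 hw).1,
    fun x hx => (mem_omega _).2 fun w hw => (isInductive_iff.1 hw).2 _ ((mem_omega _).1 hx w hw)⟩

noncomputable instance : Zero (El (omega V)) := ⟨⟨emp V, (isInductive_iff.1 isInductive_omega).1⟩⟩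

theorem omega_zero_val : (0 : El (omega V)).val = emp V := rfl

noncomputable def osucc (n : El (omega V)) : El (omega V) :=
  ⟨insertV n.val n.val, (isInductive_iff.1 isInductive_omega).2 _ n.mem⟩

theorem osucc_val (n : El (omega V)) : (osucc n).val = insertV n.val n.val := rfl

/-- Definability of `P` is essential: `omega V` is least only among inductive sets of the model, and
may contain nonstandard elements. -/
theorem omega_induction {P : El (omega V) → Prop} (hP : DFun V P) (zero : P 0)
    (succ : ∀ n, P n → P (osucc n)) (n : El (omega V)) : P n := by
  obtain ⟨w, hw⟩ := exists_subset hP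
  have hi : IsInductive w := by
    refine isInductive_iff.2 ⟨(hw _).2 ⟨(0 : El (omega V)).mem, zero⟩, fun x hx => ?_⟩
    obtain ⟨h, h'⟩ := (hw _).1 hx
    exact (hw _).2 ⟨(osucc ⟨x, h⟩).mem, succ _ h'⟩
  exact ((hw _).1 ((mem_omega _).1 n.mem w hi)).2

theorem osucc_ne_zero (n : El (omega V)) : osucc n ≠ 0 := fun h => by
  have := congrArg El.val h
  rw [osucc_val, omega_zero_val, ext_iff] at this
  exact not_mem_emp _ ((this n.val).1 (by simp))

theorem subset_of_mem_omega (n : El (omega V)) : ∀ x, x ∈ᵥ n.val → SubsetOf x n.val := by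
  unfold SubsetOf
  refine omega_induction (P := fun n : El (omega V) => ∀ x, x ∈ᵥ n.val → ∀ z, z ∈ᵥ x → z ∈ᵥ n.val)
    (.all (.imp (by fun_prop) (.all (.imp (by fun_prop) (by fun_prop))))) ?_ ?_ n
  · intro x hx
    exact (not_mem_emp _ hx).elim
  · intro n ih x hx z hz
    rw [osucc_val, mem_insertV] at hx ⊢
    rcases hx with hx | rfl
    · exact Or.inl (ih x hx z hz)
    · exact Or.inl hz

/-- If `m ≠ n`, then `m ∈ n` and `n ∈ m`; transitivity gives `m ∈ m`, against foundation. -/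
theorem osucc_inj {m n : El (omega V)} (h : osucc m = osucc n) : m = n := by
  have h' := fun z => ext_iff.1 (congrArg El.val h) z
  simp only [osucc_val, mem_insertV] at h'
  have h1 := (h' m.val).1 (Or.inr rfl)
  have h2 := (h' n.val).2 (Or.inr rfl)
  rcases h1 with h1 | h1
  · rcases h2 with h2 | h2
    · exact (not_mem_self _ (subset_of_mem_omega _ _ h1 _ h2)).elim
    · exact El.ext h2.symm
  · exact El.ext h1

theorem emp_mem_osucc (n : El (omega V)) : emp V ∈ᵥ (osucc n).val := by
  refine omega_induction (P := fun n : El (omega V) => emp V ∈ᵥ (osucc n).val) (by fun_prop) ?_ ?_ n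
  · rw [osucc_val]; simp [omega_zero_val]
  · intro n ih
    rw [osucc_val]; simp [ih]

/-- Directedness is all that the convergence arguments need from the order on `omega V`. -/
theorem exists_gt_gt (m n : El (omega V)) : ∃ k : El (omega V), m.val ∈ᵥ k.val ∧ n.val ∈ᵥ k.val := by
  have hmono (k : El (omega V)) : ∀ n : El (omega V), n.val ∈ᵥ k.val →
      (osucc n).val ∈ᵥ (osucc k).val := by
    refine omega_induction (P := fun k : El (omega V) => ∀ n : El (omega V), n.val ∈ᵥ k.val →
      (osucc n).val ∈ᵥ (osucc k).val) (.all (.imp (by fun_prop) (by fun_prop))) ?_ ?_ k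
    · intro n hn
      exact (not_mem_emp _ hn).elim
    · intro k ih n hn
      rw [osucc_val k, mem_insertV] at hn
      rw [osucc_val (osucc k), mem_insertV]
      rcases hn with hn | hn
      · exact Or.inl (ih n hn)
      · exact Or.inr (congrArg (fun n => (osucc n).val) (El.ext hn))
  refine omega_induction (P := fun n : El (omega V) =>
    ∃ k : El (omega V), m.val ∈ᵥ k.val ∧ n.val ∈ᵥ k.val) (by fun_prop) ?_ ?_ n
  · exact ⟨osucc m, by rw [osucc_val]; simp, emp_mem_osucc m⟩
  · rintro n ⟨k, hm, hn⟩
    exact ⟨osucc k, by rw [osucc_val]; simp [hm], hmono _ _ hn⟩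

/-! ### Sets of functions -/

noncomputable def pow (a : V) : V := (IsZF.powerset a).choose

theorem mem_pow {a z : V} : z ∈ᵥ pow a ↔ ∀ x, x ∈ᵥ z → x ∈ᵥ a := (IsZF.powerset a).choose_spec z

theorem exists_funSet (a b : V) : ∃ c, ∀ g, g ∈ᵥ c ↔ g ∈ᵥ pow (prod a b) ∧
    ∀ x : El a, ∃ y : El b, ∀ z : El b, pair x.val z.val ∈ᵥ g ↔ z = y :=
  exists_sep_of_dFun (.all (.ex (.all (by fun_prop)))) _

noncomputable def funSet (a b : V) : V := (exists_funSet a b).choose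

theorem mem_funSet {a b g : V} : g ∈ᵥ funSet a b ↔ g ∈ᵥ pow (prod a b) ∧
    ∀ x : El a, ∃ y : El b, ∀ z : El b, pair x.val z.val ∈ᵥ g ↔ z = y :=
  (exists_funSet a b).choose_spec g

noncomputable def ev {a b : V} (g : El (funSet a b)) (x : El a) : El b :=
  ((mem_funSet.1 g.mem).2 x).choose

theorem eq_ev_iff {a b : V} {g : El (funSet a b)} {x : El a} {z : El b} :
    z = ev g x ↔ pair x.val z.val ∈ᵥ g.val :=
  (((mem_funSet.1 g.mem).2 x).choose_spec z).symm

theorem ev_injective {a b : V} : Function.Injective (ev : El (funSet a b) → El a → El b) := by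
  intro g g' h
  have key (g g' : El (funSet a b)) (h : ev g = ev g') (p : V) (hp : p ∈ᵥ g.val) : p ∈ᵥ g'.val := by
    obtain ⟨x, y, rfl⟩ := mem_prod.1 (mem_pow.1 (mem_funSet.1 g.mem).1 p hp)
    rw [← eq_ev_iff] at hp ⊢
    rw [hp, h]
  exact El.ext (ext_iff.2 fun p => ⟨key g g' h p, key g' g h.symm p⟩)

@[fun_prop]
theorem DFun.ev {a b : V} {f : E → El (funSet a b)} {g : E → El a} (hf : DFun V f)
    (hg : DFun V g) : DFun V fun e => ev (f e) (g e) :=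
  .of_iff (Q := fun e z => ZFModel.pair (g e).val z.val ∈ᵥ (f e).val) (by fun_prop)
    fun _ _ => eq_ev_iff

theorem exists_ev_eq {a b : V} {f : El a → El b} (hf : DFun V f) : ∃ g, ev g = f := by
  obtain ⟨g, hg⟩ := exists_image (f := fun x : El a => pair x.val (f x).val) (by fun_prop)
  have key (x : El a) (z : El b) : pair x.val z.val ∈ᵥ g ↔ z = f x := by
    rw [hg]
    constructor
    · rintro ⟨x', h⟩
      obtain ⟨h1, h2⟩ := pair_inj.1 h
      rw [El.ext h1]
      exact El.ext h2
    · rintro rfl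
      exact ⟨x, rfl⟩
  have hmem : g ∈ᵥ funSet a b := by
    refine mem_funSet.2 ⟨mem_pow.2 fun p hp => ?_, fun x => ⟨f x, key x⟩⟩
    obtain ⟨x, rfl⟩ := (hg p).1 hp
    exact mem_prod.2 ⟨_, _, rfl⟩
  refine ⟨⟨g, hmem⟩, funext fun x => ?_⟩
  rw [eq_comm, eq_ev_iff, key]

theorem dFun_ev {a b : V} (g : El (funSet a b)) : DFun V (ev g) := by fun_prop

end SetTheory

/-! ### Recursion on the natural numbers of the model -/

section Recursion

variable {V : Type u} [EpsStructure V] [IsZF V]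

/-- The graph of the recursive function is the least subset of `ω × b` that contains `(0, x₀)` and
is closed under `(m, r) ↦ (m + 1, f r)`. Quantifying over the power set makes it definable, and
internal induction shows that it is single-valued. -/
theorem exists_rec {b : V} (x₀ : El b) {f : El b → El b} (hf : DFun V f) :
    ∃ c : El (omega V) → El b, DFun V c ∧ c 0 = x₀ ∧ ∀ n, c (osucc n) = f (c n) := by
  let Rel (n : El (omega V)) (r : El b) : Prop := ∀ G : El (pow (prod (omega V) b)),
    (El.mkPair (0 : El (omega V)) x₀).val ∈ᵥ G.val →
    (∀ (m : El (omega V)) (r : El b), (El.mkPair m r).val ∈ᵥ G.val →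
      (El.mkPair (osucc m) (f r)).val ∈ᵥ G.val) → (El.mkPair n r).val ∈ᵥ G.val
  have hRel : DFun V fun p : El (omega V) × El b => Rel p.1 p.2 :=
    .all (.imp (by fun_prop) (.imp (.all (.all (.imp (by fun_prop) (by fun_prop)))) (by fun_prop)))
  have elim (Q : El (omega V) → El b → Prop)
      (hQ : DFun V fun p : El (omega V) × El b => Q p.1 p.2) (h0 : Q 0 x₀)
      (hs : ∀ n r, Q n r → Q (osucc n) (f r)) (n : El (omega V)) (r : El b) (h : Rel n r) :
      Q n r := by
    obtain ⟨G, hG⟩ := exists_subset (P := fun d : El (prod (omega V) b) => Q d.fst d.snd)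
      (hQ.comp (f := fun d : El (prod (omega V) b) => (d.fst, d.snd)) (by fun_prop))
    have hG' (n : El (omega V)) (r : El b) : (El.mkPair n r).val ∈ᵥ G ↔ Q n r := by
      rw [hG]
      have : ∀ h, (⟨(El.mkPair n r).val, h⟩ : El (prod (omega V) b)) = El.mkPair n r := fun _ => rfl
      simp [this, (El.mkPair n r).mem]
    have hmem : G ∈ᵥ pow (prod (omega V) b) := mem_pow.2 fun p hp => ((hG p).1 hp).1
    have := h ⟨G, hmem⟩ ((hG' _ _).2 h0) fun n r h => (hG' _ _).2 (hs _ _ ((hG' _ _).1 h))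
    exact (hG' _ _).1 this
  have rel0 : Rel 0 x₀ := fun G h _ => h
  have relS (n r) (h : Rel n r) : Rel (osucc n) (f r) := fun G h0 hs => hs _ _ (h G h0 hs)
  have hRel' : DFun V fun p : (El (omega V) × El b) × El b => Rel p.1.1 p.2 :=
    hRel.comp (f := fun p : (El (omega V) × El b) × El b => (p.1.1, p.2)) (by fun_prop)
  have key (n : El (omega V)) : ∃ r₀, ∀ r, Rel n r ↔ r = r₀ := by
    refine omega_induction (P := fun n => ∃ r₀, ∀ r, Rel n r ↔ r = r₀)
      (.ex (.all (.iff hRel' (by fun_prop)))) ?_ ?_ n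
    · refine ⟨x₀, fun r => ⟨fun h => ?_, fun h => h ▸ rel0⟩⟩
      exact elim (fun n r => n = 0 → r = x₀) (.imp (by fun_prop) (by fun_prop)) (fun _ => rfl)
        (fun n r _ h => (osucc_ne_zero n h).elim) 0 r h rfl
    · rintro n ⟨r₀, h₀⟩
      refine ⟨f r₀, fun r => ⟨fun h => ?_, fun h => h ▸ relS _ _ ((h₀ r₀).2 rfl)⟩⟩
      -- Carrying `Rel m r` along supplies, at the step from `m = n`, the induction hypothesis `r =
      -- r₀`.
      refine (elim (fun m r => Rel m r ∧ (m = osucc n → r = f r₀))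
        (hRel.and (.imp (by fun_prop) (by fun_prop))) ⟨rel0, fun h => (osucc_ne_zero n h.symm).elim⟩
        (fun m r h => ⟨relS _ _ h.1, fun h' => ?_⟩) (osucc n) r h).2 rfl
      rw [(h₀ r).1 (osucc_inj h' ▸ h.1)]
  choose c hc using key
  refine ⟨c, .of_iff (Q := fun n r => Rel n r) hRel fun n r => (hc n r).symm,
    ((hc 0 x₀).1 rel0).symm, fun n => ((hc _ _).1 (relS _ _ ((hc n _).2 rfl))).symm⟩

end Recursion

/-! ### Finite sets of the model -/

section Finite

variable {V : Type u} [EpsStructure V] [IsZF V]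

/-- Stated through the graph, the condition quantifies only over elements of `V`. This makes
equipotence definable and hence usable in internal induction. -/
theorem equipotent_iff {k a : V} : Equipotent k a ↔ ∃ g : V,
    (∀ p, p ∈ᵥ g → ∃ x y, x ∈ᵥ k ∧ y ∈ᵥ a ∧ p = pair x y) ∧
    (∀ x, x ∈ᵥ k → ∃ y, ∀ z, pair x z ∈ᵥ g ↔ z = y) ∧
    (∀ y, y ∈ᵥ a → ∃ x, ∀ z, pair z y ∈ᵥ g ↔ z = x) := by
  constructor
  · rintro ⟨f, ⟨g, hg⟩, hinj, hsurj⟩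
    refine ⟨g, fun p hp => ?_, fun x hx => ⟨(f ⟨x, hx⟩).val, fun z => ?_⟩, fun y hy => ?_⟩
    · obtain ⟨x, rfl⟩ := (hg p).1 hp
      exact ⟨_, _, x.mem, (f x).mem, rfl⟩
    · rw [hg]
      constructor
      · rintro ⟨x', h⟩
        obtain ⟨rfl, h2⟩ := pair_inj.1 h
        exact h2
      · rintro rfl
        exact ⟨⟨x, hx⟩, rfl⟩
    · obtain ⟨x, hx⟩ := hsurj ⟨y, hy⟩
      refine ⟨x.val, fun z => ?_⟩
      rw [hg]
      constructor
      · rintro ⟨x', h⟩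
        obtain ⟨rfl, h2⟩ := pair_inj.1 h
        exact congrArg El.val (hinj ((El.ext h2.symm : f x' = ⟨y, hy⟩).trans hx.symm))
      · rintro rfl
        exact ⟨x, by simp only [hx]⟩
  · rintro ⟨g, h1, h2, h3⟩
    choose f hf using fun x : El k => h2 x.val x.mem
    choose f' hf' using fun y : El a => h3 y.val y.mem
    have hmem (x : El k) : f x ∈ᵥ a := by
      obtain ⟨x', y', -, hy, h⟩ := h1 _ ((hf x _).2 rfl)
      rwa [(pair_inj.1 h).2]
    have hmem' (y : El a) : f' y ∈ᵥ k := by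
      obtain ⟨x', y', hx, -, h⟩ := h1 _ ((hf' y _).2 rfl)
      rwa [(pair_inj.1 h).1]
    refine ⟨fun x => ⟨f x, hmem x⟩, ⟨g, fun p => ⟨fun hp => ?_, ?_⟩⟩, fun x x' h => ?_, fun y => ?_⟩
    · obtain ⟨x, y, hx, hy, rfl⟩ := h1 p hp
      exact ⟨⟨x, hx⟩, by rw [(hf ⟨x, hx⟩ y).1 hp]⟩
    · rintro ⟨x, rfl⟩
      exact (hf x _).2 rfl
    · have e : f x = f x' := congrArg El.val h
      have i1 := (hf' ⟨f x, hmem x⟩ _).1 ((hf x _).2 rfl)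
      have i2 := (hf' ⟨f x, hmem x⟩ x'.val).1 ((hf x' _).2 e)
      exact El.ext (i1.trans i2.symm)
    · exact ⟨⟨f' y, hmem' y⟩, El.ext ((hf ⟨f' y, hmem' y⟩ y.val).1 ((hf' y _).2 rfl)).symm⟩

theorem DFun.equipotent {E : Type*} [Coded V E] {f g : E → V} (hf : DFun V f) (hg : DFun V g) :
    DFun V fun e => Equipotent (f e) (g e) := by
  simp only [equipotent_iff]
  exact .ex (.and (.all (.imp (by fun_prop) (by fun_prop)))
    (.and (.all (.imp (by fun_prop) (.ex (.all (by fun_prop)))))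
      (.all (.imp (by fun_prop) (.ex (.all (by fun_prop)))))))

theorem equipotent_emp_iff {a : V} : Equipotent (emp V) a ↔ a = emp V := by
  rw [equipotent_iff]
  constructor
  · rintro ⟨g, h1, -, h3⟩
    refine isEmptySet_iff.1 fun y hy => ?_
    obtain ⟨x, hx⟩ := h3 y hy
    obtain ⟨x', _, hx', _⟩ := h1 _ ((hx x).2 rfl)
    exact not_mem_emp _ hx'
  · rintro rfl
    exact ⟨emp V, fun p hp => (not_mem_emp _ hp).elim, fun x hx => (not_mem_emp _ hx).elim,
      fun x hx => (not_mem_emp _ hx).elim⟩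

theorem Equipotent.insertV {k a j s : V} (h : Equipotent k a) (hj : ¬ j ∈ᵥ k) (hs : ¬ s ∈ᵥ a) :
    Equipotent (insertV k j) (insertV a s) := by
  obtain ⟨g, h1, h2, h3⟩ := equipotent_iff.1 h
  have hj' (z) (hz : pair j z ∈ᵥ g) : False := by
    obtain ⟨x, y, hx, hy, e⟩ := h1 _ hz
    exact hj ((pair_inj.1 e).1 ▸ hx)
  have hs' (z) (hz : pair z s ∈ᵥ g) : False := by
    obtain ⟨x, y, hx, hy, e⟩ := h1 _ hz
    exact hs ((pair_inj.1 e).2 ▸ hy)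
  refine equipotent_iff.2 ⟨ZFModel.insertV g (pair j s), fun p hp => ?_, fun x hx => ?_, fun y hy => ?_⟩
  · rcases mem_insertV.1 hp with hp | rfl
    · obtain ⟨x, y, hx, hy, e⟩ := h1 _ hp
      exact ⟨x, y, mem_insertV.2 (Or.inl hx), mem_insertV.2 (Or.inl hy), e⟩
    · exact ⟨j, s, mem_insertV.2 (Or.inr rfl), mem_insertV.2 (Or.inr rfl), rfl⟩
  · simp only [mem_insertV, pair_inj] at hx ⊢
    rcases hx with hx | rfl
    · obtain ⟨y, hy⟩ := h2 x hx
      exact ⟨y, fun z => by rw [← hy]; exact or_iff_left fun h => hj (h.1 ▸ hx)⟩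
    · exact ⟨s, fun z => by simpa using fun h => (hj' z h).elim⟩
  · simp only [mem_insertV, pair_inj] at hy ⊢
    rcases hy with hy | rfl
    · obtain ⟨x, hx⟩ := h3 y hy
      exact ⟨x, fun z => by rw [← hx]; exact or_iff_left fun h => hs (h.2 ▸ hy)⟩
    · exact ⟨j, fun z => by simpa using fun h => (hs' z h).elim⟩

/-- Delete from `a` the image `s` of `j`, and the pair `(j, s)` from the graph. -/
theorem Equipotent.exists_of_insertV {k a j : V} (h : Equipotent (ZFModel.insertV k j) a)
    (hj : ¬ j ∈ᵥ k) : ∃ a' s, ¬ s ∈ᵥ a' ∧ a = ZFModel.insertV a' s ∧ Equipotent k a' := by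
  obtain ⟨g, h1, h2, h3⟩ := equipotent_iff.1 h
  obtain ⟨s, hs⟩ := h2 j (mem_insertV.2 (Or.inr rfl))
  have hsa : s ∈ᵥ a := by
    obtain ⟨x, y, hx, hy, e⟩ := h1 _ ((hs s).2 rfl)
    exact (pair_inj.1 e).2 ▸ hy
  have hsj (z) (hz : pair z s ∈ᵥ g) : z = j := by
    obtain ⟨x, hx⟩ := h3 s hsa
    rw [(hx z).1 hz, (hx j).1 ((hs s).2 rfl)]
  obtain ⟨a', ha'⟩ := exists_sep_of_dFun (P := fun z => ¬ z = s) (by fun_prop) a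
  obtain ⟨g', hg'⟩ := exists_sep_of_dFun (P := fun z => ¬ z = pair j s) (by fun_prop) g
  refine ⟨a', s, by simp [ha'], ?_, equipotent_iff.2 ⟨g', fun p hp => ?_, fun x hx => ?_,
    fun y hy => ?_⟩⟩
  · rw [ext_iff]
    intro z
    rw [mem_insertV, ha']
    by_cases hz : z = s
    · simp [hz, hsa]
    · simp [hz]
  · obtain ⟨hp, hne⟩ := (hg' p).1 hp
    obtain ⟨x, y, hx, hy, rfl⟩ := h1 _ hp
    have hys : ¬ y = s := fun e => hne (by rw [pair_inj, e]; exact ⟨hsj x (e ▸ hp), rfl⟩)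
    refine ⟨x, y, (mem_insertV.1 hx).resolve_right fun e => hys ((hs y).1 (e ▸ hp)),
      (ha' y).2 ⟨hy, hys⟩, rfl⟩
  · obtain ⟨y, hy⟩ := h2 x (mem_insertV.2 (Or.inl hx))
    refine ⟨y, fun z => ?_⟩
    rw [hg', ← hy, pair_inj]
    exact and_iff_left fun h => hj (h.1 ▸ hx)
  · obtain ⟨hy, hne⟩ := (ha' y).1 hy
    obtain ⟨x, hx⟩ := h3 y hy
    refine ⟨x, fun z => ?_⟩
    rw [hg', ← hx, pair_inj]
    exact and_iff_left fun h => hne h.2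

theorem Equipotent.osucc {k : El (omega V)} {a s : V} (h : Equipotent k.val a) (hs : ¬ s ∈ᵥ a) :
    Equipotent (osucc k).val (ZFModel.insertV a s) :=
  h.insertV (not_mem_self _) hs

/-- Internal induction on the cardinality `k`, for all sets `a` equipotent to `k` at once. -/
theorem IsFiniteSet.induction {P : V → Prop} (hP : DFun V P) (empty : P (emp V))
    (insert : ∀ a s, ¬ s ∈ᵥ a → P a → P (insertV a s)) {a : V} (ha : IsFiniteSet a) : P a := by
  obtain ⟨k, hk⟩ := ha
  suffices H : ∀ a, Equipotent k.val a → P a from H a hk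
  refine omega_induction (P := fun k => ∀ a, Equipotent k.val a → P a)
    (.all (.imp (.equipotent (by fun_prop) (by fun_prop)) (by fun_prop))) ?_ ?_ k
  · intro a ha
    rwa [equipotent_emp_iff.1 ha]
  · intro k ih a ha
    obtain ⟨a', s, hs, rfl, h⟩ := Equipotent.exists_of_insertV ha (not_mem_self _)
    exact insert _ _ hs (ih _ h)

end Finite

/-! ### Definability of the real operations, suprema and the natural cast -/

section RealNumbers

variable {V : Type u} [EpsStructure V] [IsZF V] {R : Reals V} {E : Type*} [Coded V E]

@[fun_prop]
theorem DFun.add {f g : E → R.Carrier} (hf : DFun V f) (hg : DFun V g) :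
    DFun V fun e => f e + g e :=
  (Internal₂.dFun R.add_internal).comp (hf.prodMk hg)

@[fun_prop]
theorem DFun.mul {f g : E → R.Carrier} (hf : DFun V f) (hg : DFun V g) :
    DFun V fun e => f e * g e :=
  (Internal₂.dFun R.mul_internal).comp (hf.prodMk hg)

@[fun_prop]
theorem DFun.lt {f g : E → R.Carrier} (hf : DFun V f) (hg : DFun V g) :
    DFun V fun e => f e < g e :=
  (InternalRel.dFun R.lt_internal).comp (hf.prodMk hg)

@[fun_prop]
theorem DFun.le {f g : E → R.Carrier} (hf : DFun V f) (hg : DFun V g) :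
    DFun V fun e => f e ≤ g e :=
  (hg.lt hf).not.congr fun _ => propext not_lt.symm

@[fun_prop]
theorem DFun.neg {f : E → R.Carrier} (hf : DFun V f) : DFun V fun e => - f e :=
  .of_iff (Q := fun e y => y + f e = 0) (by fun_prop) fun _ _ => eq_neg_iff_add_eq_zero

@[fun_prop]
theorem DFun.abs {f : E → R.Carrier} (hf : DFun V f) : DFun V fun e => |f e| :=
  (DFun.ite (P := fun e => f e ≤ 0) (hf.le (.const 0)) hf.neg hf).congr fun e => by
    split_ifs with h
    · exact abs_of_nonpos h
    · exact abs_of_pos (not_le.1 h)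

theorem exists_isLUB {P : R.Carrier → Prop} (hP : DFun V P) (hne : ∃ x, P x)
    (hbdd : ∃ b, ∀ x, P x → x ≤ b) : ∃ l, IsLUB {x | P x} l := by
  obtain ⟨s, hs⟩ := exists_subset hP
  have key (x : R.Carrier) : x.val ∈ᵥ s ↔ P x := by
    rw [hs]
    exact ⟨fun ⟨_, h⟩ => h, fun h => ⟨x.mem, h⟩⟩
  have := R.complete s (by simpa only [key]) (by simpa only [key])
  simpa only [key]

theorem exists_isNatCast (R : Reals V) : ∃ c, IsNatCast R c ∧ DFun V c ∧ c 0 = 0 ∧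
    ∀ n, c (osucc n) = c n + 1 := by
  obtain ⟨c, hc, h0, hs⟩ := exists_rec (0 : R.Carrier) (f := fun r => r + 1) (by fun_prop)
  refine ⟨c, ⟨hc.val.internal, fun n hn => ?_, fun n m h => ?_⟩, hc, h0, hs⟩
  · rwa [show n = 0 from El.ext (isEmptySet_iff.1 hn)]
  · rw [show m = osucc n from El.ext (isSucc_iff.1 h), hs]

end RealNumbers

/-! ### Banach spaces of bounded functions in the model -/

section FunctionSpaces

variable {V : Type u} [EpsStructure V] [IsZF V] {R : Reals V} {E : Type*} [Coded V E]

theorem DFun.isLUB {P : E → R.Carrier → Prop} (hP : DFun V fun p : E × R.Carrier => P p.1 p.2)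
    {f : E → R.Carrier} (hf : DFun V f) : DFun V fun e => IsLUB {x | P e x} (f e) := by
  have h : DFun V fun p : (E × R.Carrier) × R.Carrier => P p.1.1 p.2 :=
    hP.comp (f := fun p : (E × R.Carrier) × R.Carrier => (p.1.1, p.2)) (by fun_prop)
  have h2 : DFun V fun p : E × R.Carrier => ∀ x, P p.1 x → x ≤ p.2 :=
    .all (.imp h (by fun_prop))
  exact (h2.comp (f := fun e => (e, f e)) (by fun_prop)).and (.all (.imp h2 (by fun_prop)))

theorem DFun.of_isLUB {P : E → R.Carrier → Prop} (hP : DFun V fun p : E × R.Carrier => P p.1 p.2)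
    {f : E → R.Carrier} (hf : ∀ e, IsLUB {x | P e x} (f e)) : DFun V f := by
  have h : DFun V fun p : (E × R.Carrier) × R.Carrier => P p.1.1 p.2 :=
    hP.comp (f := fun p : (E × R.Carrier) × R.Carrier => (p.1.1, p.2)) (by fun_prop)
  refine .of_iff (Q := fun e r => IsLUB {x | P e x} r)
    (DFun.isLUB (P := fun p : E × R.Carrier => P p.1) h (by fun_prop)) fun e r =>
    ⟨fun h => h ▸ hf e, fun h => h.unique (hf e)⟩

/-- A set of functions on `D` that is definable and consists of definable functions is, up to a
definable bijection, a set of `V`. -/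
theorem exists_equiv_functions {D b : V} (W : Set (El D → El b)) (hW : ∀ f ∈ W, DFun V f)
    (hdef : DFun V fun g : El (funSet D b) => ev g ∈ W) :
    ∃ (C : V) (e : El C ≃ W), DFun V fun p : El C × El D => (e p.1).1 p.2 := by
  obtain ⟨C, hC⟩ := exists_subset hdef
  have h1 (x : El C) : x.val ∈ᵥ funSet D b := ((hC _).1 x.mem).1
  let ι (x : El C) : El (funSet D b) := ⟨x.val, h1 x⟩
  have hι : DFun V ι := DFun.of_val (show DFun V fun x : El C => x.val by fun_prop)
  have h2 (x : El C) : ev (ι x) ∈ W := ((hC _).1 x.mem).2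
  let e (x : El C) : W := ⟨ev (ι x), h2 x⟩
  have he : Function.Bijective e := by
    refine ⟨fun x y h => ?_, fun f => ?_⟩
    · have := ev_injective (congrArg Subtype.val h)
      exact El.ext (congrArg (fun g : El (funSet D b) => g.val) this)
    · obtain ⟨g, hg⟩ := exists_ev_eq (hW f.1 f.2)
      have hgW : ev g ∈ W := hg ▸ f.2
      exact ⟨⟨g.val, (hC _).2 ⟨g.mem, hgW⟩⟩, Subtype.ext hg⟩
  refine ⟨C, Equiv.ofBijective e he, ?_⟩
  change DFun V fun p : El C × El D => ev (ι p.1) p.2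
  fun_prop

/-- The graphs of the functions in `W` form a set of the model; the vector space structure is
transported to it, and the norm is the supremum of `|f d|`. The norm is exposed only through its
bounds, which is all that later arguments use. -/
theorem exists_normedSpace {D : V} [Nonempty (El D)] (W : Submodule R.Carrier (El D → R.Carrier))
    (hW : ∀ f ∈ W, DFun V f) (hbdd : ∀ f ∈ W, ∃ K, ∀ d, |f d| ≤ K)
    (hdef : DFun V fun g : El (funSet D R.carrier) => ev g ∈ W) :
    ∃ (X : NormedSpaceIn R) (e : X.Carrier ≃ₗ[R.Carrier] W),
      (DFun V fun p : X.Carrier × El D => (e p.1).1 p.2) ∧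
      ∀ x c, X.norm x ≤ c ↔ ∀ d, |(e x).1 d| ≤ c := by
  obtain ⟨C, e, he⟩ := exists_equiv_functions (W : Set (El D → R.Carrier)) hW hdef
  let e' : El C ≃ W := e
  let _ : AddCommGroup (El C) := e'.addCommGroup
  let _ : Module R.Carrier (El C) := e'.module R.Carrier
  let L : El C ≃ₗ[R.Carrier] W := e'.linearEquiv R.Carrier
  have hL : DFun V fun p : El C × El D => (L p.1).1 p.2 := he
  have hL' {F : Type u} [Coded V F] {f : F → El C} {g : F → El D} (hf : DFun V f)
      (hg : DFun V g) : DFun V fun x => (L (f x)).1 (g x) := hL.comp (hf.prodMk hg)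
  have hext (x y : El C) : x = y ↔ ∀ d, (L x).1 d = (L y).1 d := by
    rw [← L.injective.eq_iff, Subtype.ext_iff, funext_iff]
  have hP : DFun V fun p : El C × R.Carrier => ∃ d, p.2 = |(L p.1).1 d| :=
    .ex (.eq (by fun_prop) (.abs (hL' (by fun_prop) (by fun_prop))))
  have hlub (x : El C) : ∃ l, IsLUB {r | ∃ d, r = |(L x).1 d|} l := by
    refine exists_isLUB (hP.comp (f := fun r => (x, r)) (by fun_prop)) ?_ ?_
    · obtain ⟨d⟩ := ‹Nonempty (El D)›
      exact ⟨_, d, rfl⟩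
    · obtain ⟨K, hK⟩ := hbdd _ (L x).2
      refine ⟨K, ?_⟩
      rintro _ ⟨d, rfl⟩
      exact hK d
  choose norm hnorm using hlub
  have norm_le (x : El C) (c : R.Carrier) : norm x ≤ c ↔ ∀ d, |(L x).1 d| ≤ c := by
    rw [isLUB_le_iff (hnorm x)]
    simp [upperBounds]
  have le_norm (x : El C) (d : El D) : |(L x).1 d| ≤ norm x := (norm_le x _).1 le_rfl d
  have norm_nonneg (x : El C) : 0 ≤ norm x := by
    obtain ⟨d⟩ := ‹Nonempty (El D)›
    exact (abs_nonneg _).trans (le_norm x d)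
  have smul_le (c : R.Carrier) (x : El C) : norm (c • x) ≤ |c| * norm x := by
    rw [norm_le]
    intro d
    rw [map_smul]
    change |c * (L x).1 d| ≤ _
    rw [abs_mul]
    exact mul_le_mul_of_nonneg_left (le_norm x d) (abs_nonneg c)
  let X : NormedSpaceIn R :=
    { carrier := C
      group := inferInstance
      module := inferInstance
      norm := norm
      add_internal := by
        refine DFun.internal₂ (DFun.val (.of_iff (Q := fun p z => ∀ d, (L z).1 d = (L p.1).1 d
          + (L p.2).1 d) ?_ fun p z => ?_))
        · exact .all (.eq (hL' (by fun_prop) (by fun_prop)) (.add (hL' (by fun_prop) (by fun_prop))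
            (hL' (by fun_prop) (by fun_prop))))
        · rw [hext]
          simp
      smul_internal := by
        refine DFun.internal₂ (DFun.val (.of_iff (Q := fun p z => ∀ d, (L z).1 d = p.1
          * (L p.2).1 d) ?_ fun p z => ?_))
        · exact .all (.eq (hL' (by fun_prop) (by fun_prop)) (.mul (by fun_prop)
            (hL' (by fun_prop) (by fun_prop))))
        · rw [hext]
          simp
      norm_internal := (DFun.of_isLUB hP hnorm).val.internal
      norm_eq_zero := fun x => by
        rw [hext]
        constructor
        · intro h d
          have := le_norm x d
          rw [h, abs_nonpos_iff] at this
          simpa using this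
        · intro h
          refine le_antisymm ((norm_le x 0).2 fun d => ?_) (norm_nonneg x)
          rw [h d]
          simp
      norm_smul := fun c x => by
        refine le_antisymm (smul_le c x) ?_
        by_cases hc : c = 0
        · simpa [hc] using norm_nonneg _
        -- The reverse inequality follows from the one already proved, applied to `c⁻¹` and `c • x`.
        · have := smul_le c⁻¹ (c • x)
          rw [smul_smul, inv_mul_cancel₀ hc, one_smul, abs_inv] at this
          have h := mul_le_mul_of_nonneg_left this (abs_nonneg c)
          rwa [mul_inv_cancel_left₀ (abs_ne_zero.2 hc)] at h
      norm_add_le := fun x y => by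
        rw [norm_le]
        intro d
        rw [map_add]
        exact (abs_add_le _ _).trans (add_le_add (le_norm x d) (le_norm y d)) }
  exact ⟨X, L, hL, norm_le⟩

/-- The limit of a Cauchy sequence is its pointwise limit inferior, the supremum of the eventual
lower bounds. It is definable and uniformly close to the tail of the sequence, so closedness of `W`
under uniform limits puts it in `W`. -/
theorem isBanach_of_isClosed {D : V} {W : Submodule R.Carrier (El D → R.Carrier)}
    {X : NormedSpaceIn R} (e : X.Carrier ≃ₗ[R.Carrier] W)
    (he : DFun V fun p : X.Carrier × El D => (e p.1).1 p.2)
    (norm_le : ∀ x c, X.norm x ≤ c ↔ ∀ d, |(e x).1 d| ≤ c)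
    (closed : ∀ l, DFun V l → (∀ ε : R.Carrier, 0 < ε → ∃ f ∈ W, ∀ d, |f d - l d| ≤ ε) → l ∈ W) :
    IsBanach X := by
  intro u hu hcauchy
  have hu' : DFun V u := hu.dFun
  have hud : DFun V fun p : El (omega V) × El D => (e (u p.1)).1 p.2 :=
    he.comp (f := fun p : El (omega V) × El D => (u p.1, p.2)) (by fun_prop)
  have hc (ε : R.Carrier) (hε : 0 < ε) : ∃ N : El (omega V), ∀ m n : El (omega V),
      N.val ∈ᵥ m.val → N.val ∈ᵥ n.val → ∀ d, |(e (u m)).1 d - (e (u n)).1 d| ≤ ε := by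
    obtain ⟨N, hN⟩ := hcauchy ε hε
    refine ⟨N, fun m n hm hn d => ?_⟩
    have := (norm_le _ _).1 (hN m n hm hn).le d
    rwa [map_sub] at this
  let P (d : El D) (r : R.Carrier) : Prop :=
    ∃ N : El (omega V), ∀ m : El (omega V), N.val ∈ᵥ m.val → r ≤ (e (u m)).1 d
  have hP : DFun V fun p : El D × R.Carrier => P p.1 p.2 :=
    .ex (.all (.imp (by fun_prop) (.le (by fun_prop)
      (hud.comp (f := fun p : ((El D × R.Carrier) × El (omega V)) × El (omega V) => (p.2, p.1.1.1))
        (by fun_prop)))))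
  have upper {ε : R.Carrier} {N : El (omega V)} (hN : ∀ m n : El (omega V),
      N.val ∈ᵥ m.val → N.val ∈ᵥ n.val → ∀ d, |(e (u m)).1 d - (e (u n)).1 d| ≤ ε)
      {m : El (omega V)} (hm : N.val ∈ᵥ m.val) (d : El D) (r : R.Carrier) (hr : P d r) :
      r ≤ (e (u m)).1 d + ε := by
    obtain ⟨N', hN'⟩ := hr
    obtain ⟨k, hk, hk'⟩ := exists_gt_gt N N'
    have h1 := hN' k hk'
    have h2 := (abs_le.1 (hN m k hm hk d)).1
    linarith
  have lower {ε : R.Carrier} {N : El (omega V)} (hN : ∀ m n : El (omega V),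
      N.val ∈ᵥ m.val → N.val ∈ᵥ n.val → ∀ d, |(e (u m)).1 d - (e (u n)).1 d| ≤ ε)
      {m : El (omega V)} (hm : N.val ∈ᵥ m.val) (d : El D) : P d ((e (u m)).1 d - ε) := by
    refine ⟨N, fun k hk => ?_⟩
    have h2 := (abs_le.1 (hN m k hm hk d)).2
    linarith
  have hlub (d : El D) : ∃ l, IsLUB {r | P d r} l := by
    obtain ⟨N, hN⟩ := hc 1 one_pos
    obtain ⟨m, hm, -⟩ := exists_gt_gt N N
    exact exists_isLUB (hP.comp (f := fun r => (d, r)) (by fun_prop)) ⟨_, lower hN hm d⟩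
      ⟨_, upper hN hm d⟩
  choose l hl using hlub
  have hld : DFun V l := DFun.of_isLUB hP hl
  have close {ε : R.Carrier} {N : El (omega V)} (hN : ∀ m n : El (omega V),
      N.val ∈ᵥ m.val → N.val ∈ᵥ n.val → ∀ d, |(e (u m)).1 d - (e (u n)).1 d| ≤ ε)
      {m : El (omega V)} (hm : N.val ∈ᵥ m.val) (d : El D) : |(e (u m)).1 d - l d| ≤ ε := by
    have h1 := (hl d).1 (lower hN hm d)
    have h2 := (hl d).2 (fun r hr => upper hN hm d r hr)
    rw [abs_le]
    constructor <;> linarith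
  have hlW : l ∈ W := closed l hld fun ε hε => by
    obtain ⟨N, hN⟩ := hc ε hε
    obtain ⟨m, hm, -⟩ := exists_gt_gt N N
    exact ⟨_, (e (u m)).2, close hN hm⟩
  refine ⟨e.symm ⟨l, hlW⟩, fun ε hε => ?_⟩
  -- Suprema preserve only weak inequalities; halving `ε` recovers the strict one.
  obtain ⟨N, hN⟩ := hc (ε / 2) (half_pos hε)
  refine ⟨N, fun m hm => lt_of_le_of_lt ((norm_le _ _).2 fun d => ?_) (half_lt_self hε)⟩
  rw [map_sub, LinearEquiv.apply_symm_apply]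
  exact close hN hm d

/-- The real line as a normed space of `V`. -/
def realLine (R : Reals V) : NormedSpaceIn R where
  carrier := R.carrier
  group := inferInstanceAs (AddCommGroup R.Carrier)
  module := inferInstanceAs (Module R.Carrier R.Carrier)
  norm x := |x|
  add_internal := R.add_internal
  smul_internal := R.mul_internal
  norm_internal := DFun.internal (f := fun x : R.Carrier => (|x|).val) (by fun_prop)
  norm_eq_zero _ := abs_eq_zero
  norm_smul := abs_mul
  norm_add_le := abs_add_le

/-- The uniform boundedness principle for weighted point evaluations on a closed space of bounded
functions. -/
theorem UniformBoundednessPrinciple.exists_unbounded (hUBP : UniformBoundednessPrinciple V)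
    {D : V} [Nonempty (El D)] (W : Submodule R.Carrier (El D → R.Carrier))
    (hW : ∀ f ∈ W, DFun V f) (hbdd : ∀ f ∈ W, ∃ K, ∀ d, |f d| ≤ K)
    (hdef : DFun V fun g : El (funSet D R.carrier) => ev g ∈ W)
    (closed : ∀ l, DFun V l → (∀ ε : R.Carrier, 0 < ε → ∃ f ∈ W, ∀ d, |f d - l d| ≤ ε) → l ∈ W)
    {w : El D → R.Carrier} (hw : DFun V w)
    (hunb : ∀ C, ∃ f ∈ W, (∀ d, |f d| ≤ 1) ∧ ∃ d, C < w d * f d) :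
    ∃ f ∈ W, ∀ C, ∃ d, C < w d * f d := by
  obtain ⟨X, e, he, norm_le⟩ := exists_normedSpace W hW hbdd hdef
  have le_norm (x d) : |(e x).1 d| ≤ X.norm x := (norm_le x _).1 le_rfl d
  have hB := isBanach_of_isClosed e he norm_le closed
  let T (d : El D) (x : X.Carrier) : (realLine R).Carrier := w d * (e x).1 d
  have hT : DFun V fun p : El D × X.Carrier => w p.1 * (e p.2).1 p.1 :=
    .mul (by fun_prop) (he.comp (f := fun p : El D × X.Carrier => (p.2, p.1)) (by fun_prop))
  by_contra! hcon
  -- `hcon` bounds `w d * f d` only from above; using it for both `x` and `-x` bounds the absolute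
  -- value.
  have hpt (x : X.Carrier) : ∃ C : R.Carrier, ∀ d, (realLine R).norm (T d x) ≤ C := by
    obtain ⟨C₁, h₁⟩ := hcon _ (e x).2
    obtain ⟨C₂, h₂⟩ := hcon _ (e (-x)).2
    refine ⟨max C₁ C₂, fun d => abs_le'.2 ⟨(h₁ d).trans (le_max_left _ _), ?_⟩⟩
    refine le_trans (le_of_eq ?_) ((h₂ d).trans (le_max_right _ _))
    rw [map_neg]
    exact (mul_neg _ _).symm
  obtain ⟨C, hC⟩ := hUBP R X (realLine R) hB D T (DFun.internal₂ hT.val)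
    (fun d => ⟨fun x y => by
        change w d * (e (x + y)).1 d = w d * (e x).1 d + w d * (e y).1 d
        rw [map_add, ← mul_add]; rfl,
      fun c x => by
        change w d * (e (c • x)).1 d = c * (w d * (e x).1 d)
        rw [map_smul, mul_left_comm]; rfl⟩)
    (fun d x ε hε => by
      -- The summand 1 guards against `w d = 0`.
      refine ⟨ε / (|w d| + 1), div_pos hε (by positivity), fun x' hx' => ?_⟩
      change |w d * (e x').1 d - w d * (e x).1 d| < ε
      have h1 := le_norm (x' - x) d
      rw [map_sub] at h1
      change |(e x').1 d - (e x).1 d| ≤ _ at h1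
      rw [← mul_sub, abs_mul]
      rw [lt_div_iff₀ (by positivity)] at hx'
      nlinarith [abs_nonneg (w d), abs_nonneg ((e x').1 d - (e x).1 d)])
    hpt
  obtain ⟨f, hf, hf1, d, hd⟩ := hunb C
  obtain ⟨c, hc, hcC⟩ := hC d
  -- The function from `hunb` lies in the unit ball, so it tests the operator norm of the evaluation
  -- at `d` and contradicts the uniform bound `C`.
  have := hc.1 ⟨e.symm ⟨f, hf⟩, (norm_le _ _).2 (by simpa using hf1), rfl⟩
  have h2 : |w d * f d| ≤ c := by
    have h3 : |w d * (e (e.symm ⟨f, hf⟩)).1 d| ≤ c := this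
    rwa [LinearEquiv.apply_symm_apply] at h3
  exact absurd hd (not_lt.2 ((le_abs_self _).trans (h2.trans hcC)))

end FunctionSpaces

/-! ### Bounded sequences of charges and the cardinality estimate -/

section Charges

variable {V : Type u} [EpsStructure V] [IsZF V] {R : Reals V}

def IsSingleton (b s : V) : Prop := ∀ z, z ∈ᵥ b ↔ z = s

theorem DFun.isSingleton {E : Type*} [Coded V E] {f g : E → V} (hf : DFun V f) (hg : DFun V g) :
    DFun V fun e => IsSingleton (f e) (g e) :=
  .all (by fun_prop)

theorem exists_isSingleton {U s : V} (hs : s ∈ᵥ U) : ∃ B : El (pow U), IsSingleton B.val s := by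
  refine ⟨⟨upair s s, mem_pow.2 fun x hx => ?_⟩, fun z => by simp [mem_upair]⟩
  simp only [mem_upair, or_self] at hx
  exact hx ▸ hs

/-- `f` is a sequence of finitely additive real-valued set functions on the subsets of `U`, the
`n`-th one vanishing off `S n`. -/
def IsChargeSequence (R : Reals V) (U : V) (S : El (omega V) → V)
    (f : El (prod (omega V) (pow U)) → R.Carrier) : Prop :=
  (∀ (n : El (omega V)) (A B C : El (pow U)) (s : V), ¬ s ∈ᵥ A.val → IsSingleton B.val s →
    (∀ z, z ∈ᵥ C.val ↔ z ∈ᵥ A.val ∨ z = s) →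
      f (El.mkPair n C) = f (El.mkPair n A) + f (El.mkPair n B)) ∧
  ∀ (n : El (omega V)) (A : El (pow U)), (∀ z, z ∈ᵥ A.val → ¬ z ∈ᵥ S n) → f (El.mkPair n A) = 0

/-- When each `S n` is finite, adding one point at a time shows `f_n(A) = ∑ f_n({s})` over `s ∈ A ∩
S n`, so this is the `ℓ^∞`-sum of the `ℓ¹(S n)` with an equivalent norm. All conditions are
first-order, with no mention of sums. -/
def boundedCharges (R : Reals V) (U : V) (S : El (omega V) → V) :
    Submodule R.Carrier (El (prod (omega V) (pow U)) → R.Carrier) where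
  carrier := {f | DFun V f ∧ (∃ K, ∀ d, |f d| ≤ K) ∧ IsChargeSequence R U S f}
  zero_mem' := ⟨.const 0, ⟨0, fun d => by simp⟩, fun n A B C s _ _ _ => by simp, fun n A _ => rfl⟩
  add_mem' := by
    rintro f g ⟨hf, ⟨K, hK⟩, hf1, hf2⟩ ⟨hg, ⟨K', hK'⟩, hg1, hg2⟩
    refine ⟨hf.add hg, ⟨K + K', fun d => (abs_add_le _ _).trans (add_le_add (hK d) (hK' d))⟩,
      fun n A B C s h1 h2 h3 => ?_, fun n A h => ?_⟩
    · simp only [Pi.add_apply, hf1 n A B C s h1 h2 h3, hg1 n A B C s h1 h2 h3]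
      ring
    · simp only [Pi.add_apply, hf2 n A h, hg2 n A h, add_zero]
  smul_mem' := by
    rintro c f ⟨hf, ⟨K, hK⟩, hf1, hf2⟩
    refine ⟨(DFun.const c).mul hf, ⟨|c| * K, fun d => ?_⟩,
      fun n A B C s h1 h2 h3 => ?_, fun n A h => ?_⟩
    · simp only [Pi.smul_apply, smul_eq_mul, abs_mul]
      exact mul_le_mul_of_nonneg_left (hK d) (abs_nonneg c)
    · simp only [Pi.smul_apply, smul_eq_mul, hf1 n A B C s h1 h2 h3, mul_add]
    · simp only [Pi.smul_apply, hf2 n A h, smul_zero]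

theorem mem_boundedCharges {U : V} {S : El (omega V) → V}
    {f : El (prod (omega V) (pow U)) → R.Carrier} : f ∈ boundedCharges R U S ↔
      DFun V f ∧ (∃ K, ∀ d, |f d| ≤ K) ∧ IsChargeSequence R U S f := Iff.rfl

theorem dFun_mem_boundedCharges {U : V} {S : El (omega V) → V} (hS : DFun V S) :
    DFun V fun g : El (funSet (prod (omega V) (pow U)) R.carrier) =>
      ev g ∈ boundedCharges R U S := by
  have h : DFun V fun g : El (funSet (prod (omega V) (pow U)) R.carrier) =>
      (∃ K : R.Carrier, ∀ d, |(ev g d : R.Carrier)| ≤ K) ∧ IsChargeSequence R U S (ev g) := by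
    refine .and (.ex (.all (.le (.abs (by fun_prop)) (by fun_prop)))) (.and ?_ ?_)
    · exact .all (.all (.all (.all (.all (.imp (by fun_prop)
        (.imp (.isSingleton (by fun_prop) (by fun_prop))
          (.imp (.all (by fun_prop))
            (.eq (by fun_prop) (.add (by fun_prop) (by fun_prop))))))))))
    · exact .all (.all (.imp (.all (.imp (by fun_prop) (by fun_prop))) (by fun_prop)))
  -- The clause `DFun V f` is not itself expressible in the model, but it holds automatically for a
  -- function given by its graph `g`.
  exact h.congr fun g => propext ((and_iff_right (dFun_ev g)).trans Iff.rfl)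

theorem eq_of_forall_abs_sub_le {x y c : R.Carrier} (hc : 0 < c)
    (h : ∀ ε : R.Carrier, 0 < ε → |x - y| ≤ c * ε) : x = y := by
  by_contra hxy
  have h1 : 0 < |x - y| := abs_pos.2 (sub_ne_zero.2 hxy)
  have h2 := h (|x - y| / (2 * c)) (by positivity)
  have h3 : c * (|x - y| / (2 * c)) = |x - y| / 2 := by field_simp
  linarith

/-- Each defining identity involves finitely many values, so it survives uniform limits; the
constants 3 and 1 below count the values involved. -/
theorem boundedCharges_closed {U : V} {S : El (omega V) → V}
    {l : El (prod (omega V) (pow U)) → R.Carrier} (hl : DFun V l)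
    (h : ∀ ε : R.Carrier, 0 < ε → ∃ f ∈ boundedCharges R U S, ∀ d, |f d - l d| ≤ ε) :
    l ∈ boundedCharges R U S := by
  refine mem_boundedCharges.2 ⟨hl, ?_, fun n A B C s h1 h2 h3 => ?_, fun n A hA => ?_⟩
  · obtain ⟨f, ⟨-, ⟨K, hK⟩, -⟩, hfl⟩ := h 1 one_pos
    refine ⟨K + 1, fun d => ?_⟩
    have h1 := abs_le.1 (hK d)
    have h2 := abs_le.1 (hfl d)
    rw [abs_le]
    constructor <;> linarith
  · refine eq_of_forall_abs_sub_le (c := 3) (by norm_num) fun ε hε => ?_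
    obtain ⟨f, ⟨-, -, hf, -⟩, hfl⟩ := h ε hε
    have e := hf n A B C s h1 h2 h3
    have e1 := abs_le.1 (hfl (El.mkPair n A))
    have e2 := abs_le.1 (hfl (El.mkPair n B))
    have e3 := abs_le.1 (hfl (El.mkPair n C))
    rw [abs_le]
    constructor <;> linarith
  · refine eq_of_forall_abs_sub_le (c := 1) one_pos fun ε hε => ?_
    obtain ⟨f, ⟨-, -, -, hf⟩, hfl⟩ := h ε hε
    have e := hfl (El.mkPair n A)
    rwa [hf n A hA, zero_sub, abs_neg, ← sub_zero (l _), ← one_mul ε] at e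

open Classical in
/-- The unit mass at the point `s` of `S n`. -/
theorem exists_pointMass {U : V} {S : El (omega V) → V} {n : El (omega V)} {s : V}
    (hs : s ∈ᵥ S n) : ∃ f ∈ boundedCharges R U S, (∀ d, |f d| ≤ 1) ∧
      ∀ B : El (pow U), s ∈ᵥ B.val → f (El.mkPair n B) = 1 := by
  let f (d : El (prod (omega V) (pow U))) : R.Carrier := if d.fst = n ∧ s ∈ᵥ d.snd.val then 1 else 0
  have hf1 (d) : |f d| ≤ 1 := by
    simp only [f]
    split_ifs <;> simp
  refine ⟨f, ⟨.ite (by fun_prop) (.const 1) (.const 0), ⟨1, hf1⟩, ?_, ?_⟩, hf1, fun B hB => ?_⟩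
  · intro m A B C t h1 h2 h3
    simp only [f, El.fst_mkPair, El.snd_mkPair, h2 s, h3 s]
    by_cases hm : m = n
    · by_cases hst : s = t
      · subst hst
        simp [hm, h1]
      · simp [hm, hst]
    · simp [hm]
  · intro m A hA
    simp only [f, El.fst_mkPair, El.snd_mkPair]
    refine if_neg ?_
    rintro ⟨rfl, h⟩
    exact hA s h hs
  · simp [f, hB]

/-- A charge all of whose atoms in the finite set `a ∩ M` have mass at least `t⁻¹` bounds the
cardinality of `a ∩ M`. -/
theorem exists_equipotent_le {U : V} {S : El (omega V) → V}
    {f : El (prod (omega V) (pow U)) → R.Carrier} (hf : f ∈ boundedCharges R U S)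
    {c : El (omega V) → R.Carrier} (hc : DFun V c) (hc0 : c 0 = 0)
    (hcs : ∀ n, c (osucc n) = c n + 1) (n : El (omega V)) (t : R.Carrier) {M : V}
    (hM : ∀ s, s ∈ᵥ M → ∃ B : El (pow U), IsSingleton B.val s ∧ 1 ≤ t * f (El.mkPair n B))
    {a : V} (ha : IsFiniteSet a) :
    ∃ (k : El (omega V)) (b : El (pow U)), (∀ z, z ∈ᵥ b.val ↔ z ∈ᵥ a ∧ z ∈ᵥ M) ∧
      Equipotent k.val b.val ∧ c k ≤ t * f (El.mkPair n b) := by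
  have hfd : DFun V f := hf.1
  -- Working with `b = a ∩ M` builds the finiteness of the intersection into the induction: a new
  -- point outside `M` changes nothing, and one in `M` raises both sides, the right one by at least
  -- 1.
  refine ha.induction (P := fun a => ∃ (k : El (omega V)) (b : El (pow U)),
    (∀ z, z ∈ᵥ b.val ↔ z ∈ᵥ a ∧ z ∈ᵥ M) ∧ Equipotent k.val b.val ∧ c k ≤ t * f (El.mkPair n b))
    (.ex (.ex (.and (.all (by fun_prop)) (.and (.equipotent (by fun_prop) (by fun_prop))
      (by fun_prop))))) ?_ ?_
  · refine ⟨0, ⟨emp V, mem_pow.2 fun x hx => (not_mem_emp _ hx).elim⟩, fun z => ?_,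
      equipotent_emp_iff.2 rfl, ?_⟩
    · simp [not_mem_emp]
    · rw [hf.2.2.2 n _ fun z hz => (not_mem_emp _ hz).elim, hc0, mul_zero]
  · rintro a s hs ⟨k, b, hb, hk, hkb⟩
    by_cases hsM : s ∈ᵥ M
    · obtain ⟨B, hB, hBf⟩ := hM s hsM
      have hsU : s ∈ᵥ U := mem_pow.1 B.mem s ((hB s).2 rfl)
      have hsb : ¬ s ∈ᵥ b.val := fun h => hs ((hb s).1 h).1
      let b' : El (pow U) := ⟨insertV b.val s, mem_pow.2 fun x hx => by
        rcases mem_insertV.1 hx with hx | rfl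
        · exact mem_pow.1 b.mem x hx
        · exact hsU⟩
      refine ⟨osucc k, b', fun z => ?_, hk.osucc hsb, ?_⟩
      · rw [mem_insertV, mem_insertV, hb]
        by_cases hz : z = s
        · simp [hz, hsM]
        · simp [hz]
      · rw [hf.2.2.1 n b B b' s hsb hB fun z => mem_insertV, hcs, mul_add]
        exact add_le_add hkb hBf
    · refine ⟨k, b, fun z => ?_, hk, hkb⟩
      rw [hb, mem_insertV]
      by_cases hz : z = s
      · simp [hz, hsM]
      · simp [hz]

theorem IsFiniteSet.exists_bound {lam : El (omega V) → R.Carrier} (hlam : DFun V lam) {a : V}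
    (ha : IsFiniteSet a) : ∃ C, ∀ n : El (omega V), n.val ∈ᵥ a → lam n ≤ C := by
  refine ha.induction (P := fun a => ∃ C, ∀ n : El (omega V), n.val ∈ᵥ a → lam n ≤ C)
    (.ex (.all (.imp (by fun_prop) (by fun_prop)))) ⟨0, fun n hn => (not_mem_emp _ hn).elim⟩ ?_
  rintro a s - ⟨C, hC⟩
  by_cases hs : s ∈ᵥ omega V
  · refine ⟨max C (lam ⟨s, hs⟩), fun n hn => ?_⟩
    rcases mem_insertV.1 hn with hn | hn
    · exact (hC n hn).trans (le_max_left _ _)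
    · rw [show n = ⟨s, hs⟩ from El.ext hn]
      exact le_max_right _ _
  · refine ⟨C, fun n hn => ?_⟩
    rcases mem_insertV.1 hn with hn | hn
    · exact hC n hn
    · exact (hs (hn ▸ n.mem)).elim

-- Uniform boundedness is applied to evaluations at `(n, B)` weighted by `lam n` when `B` is a
-- singleton and by 0 otherwise. Point masses show that they are unbounded on the unit ball. A
-- positive value forces `B = {s}`, and `s ∈ S n` since `f_n` vanishes off `S n`.
open Classical in
theorem UniformBoundednessPrinciple.exists_charge (hUBP : UniformBoundednessPrinciple V)
    {U : V} {S : El (omega V) → V} (hS : DFun V S) (hSU : ∀ n z, z ∈ᵥ S n → z ∈ᵥ U)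
    (hne : ∀ n, ∃ z, z ∈ᵥ S n) {lam : El (omega V) → R.Carrier} (hlam : DFun V lam)
    (hunb : ¬ ∃ C : R.Carrier, ∀ n, lam n ≤ C) :
    ∃ f ∈ boundedCharges R U S, ∀ C, 0 < C → ∃ (n : El (omega V)) (B : El (pow U)) (s : V),
      s ∈ᵥ S n ∧ IsSingleton B.val s ∧ C < lam n * f (El.mkPair n B) := by
  have : Nonempty (El (prod (omega V) (pow U))) :=
    ⟨El.mkPair 0 ⟨emp V, mem_pow.2 fun x hx => (not_mem_emp _ hx).elim⟩⟩
  let w (d : El (prod (omega V) (pow U))) : R.Carrier :=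
    if ∃ s, IsSingleton d.snd.val s then lam d.fst else 0
  have hw : DFun V w :=
    .ite (.ex (.isSingleton (by fun_prop) (by fun_prop))) (by fun_prop) (.const 0)
  obtain ⟨f, hf, hfC⟩ := hUBP.exists_unbounded (boundedCharges R U S) (fun f hf => hf.1)
    (fun f hf => hf.2.1) (dFun_mem_boundedCharges hS) (fun l hl h => boundedCharges_closed hl h) hw
    fun C => by
      obtain ⟨n, hn⟩ : ∃ n, C < lam n := by
        by_contra! h
        exact hunb ⟨C, h⟩
      obtain ⟨s, hs⟩ := hne n
      obtain ⟨f, hf, hf1, hfs⟩ := exists_pointMass (R := R) (U := U) hs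
      obtain ⟨B, hB⟩ := exists_isSingleton (hSU n s hs)
      refine ⟨f, hf, hf1, El.mkPair n B, ?_⟩
      rw [hfs B ((hB s).2 rfl), mul_one]
      simp only [w, El.fst_mkPair, El.snd_mkPair]
      rwa [if_pos ⟨s, hB⟩]
  refine ⟨f, hf, fun C hC => ?_⟩
  obtain ⟨d, hd⟩ := hfC C
  by_cases hsing : ∃ s, IsSingleton d.snd.val s
  · simp only [w, if_pos hsing] at hd
    obtain ⟨s, hs⟩ := hsing
    refine ⟨d.fst, d.snd, s, ?_, hs, by rwa [El.mkPair_eta]⟩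
    by_contra hsS
    have := hf.2.2.2 d.fst d.snd fun z hz => by rwa [(hs z).1 hz]
    rw [El.mkPair_eta] at this
    rw [this, mul_zero] at hd
    exact lt_asymm hC hd
  · simp only [w, if_neg hsing, zero_mul] at hd
    exact (lt_asymm hC hd).elim

end Charges

/-! ### From one unbounded charge sequence to the sets `M n` -/

theorem UniformBoundednessPrinciple.partialCountableAsymptoticChoice {V : Type u} [EpsStructure V]
    [IsZF V] (hUBP : UniformBoundednessPrinciple V) : PartialCountableAsymptoticChoice V := by
  intro R S hSi hfin hne lam hlami hpos hunb
  have hS : DFun V S := hSi.dFun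
  have hlam : DFun V lam := hlami.dFun
  obtain ⟨r, hr⟩ := exists_image hS
  obtain ⟨U, hU⟩ := IsZF.union r
  have hSU (n : El (omega V)) (z : V) (hz : z ∈ᵥ S n) : z ∈ᵥ U :=
    (hU z).2 ⟨_, (hr _).2 ⟨n, rfl⟩, hz⟩
  obtain ⟨f, hf, hfC⟩ := hUBP.exists_charge hS hSU hne hlam hunb
  obtain ⟨hfd, ⟨K', hK'⟩, -⟩ := id hf
  obtain ⟨K, hK0, hK⟩ : ∃ K : R.Carrier, 0 < K ∧ ∀ d, f d ≤ K :=
    ⟨max K' 1, lt_max_of_lt_right one_pos,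
      fun d => (le_abs_self _).trans ((hK' d).trans (le_max_left _ _))⟩
  let Big (n : El (omega V)) (s : V) : Prop :=
    ∃ B : El (pow U), IsSingleton B.val s ∧ 1 ≤ lam n * f (El.mkPair n B)
  have hBig : DFun V fun p : El (omega V) × V => Big p.1 p.2 :=
    .ex (.and (.isSingleton (by fun_prop) (by fun_prop)) (.le (.const 1) (by fun_prop)))
  have hM (n : El (omega V)) : ∃ m, ∀ z, z ∈ᵥ m ↔ z ∈ᵥ S n ∧ Big n z :=
    exists_sep_of_dFun (hBig.comp (f := fun z => (n, z)) (by fun_prop)) _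
  choose M hM using hM
  have hMd : DFun V M := .of_mem (by
    simp only [hM]
    exact .and (by fun_prop) hBig)
  obtain ⟨I, hI⟩ := exists_subset (P := fun n : El (omega V) => ∃ z, z ∈ᵥ M n) (by fun_prop)
  have hIω (i : El I) : i.val ∈ᵥ omega V := ((hI _).1 i.mem).1
  have hι : DFun V fun i : El I => (⟨i.val, hIω i⟩ : El (omega V)) :=
    DFun.of_val (show DFun V fun i : El I => i.val by fun_prop)
  refine ⟨I, fun z hz => hIω ⟨z, hz⟩, fun hIfin => ?_, fun i => M ⟨i.val, hIω i⟩,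
    (hMd.comp hι).internal, K, hK0, ?_⟩
  · obtain ⟨C, hC⟩ := hIfin.exists_bound hlam
    -- A value above 1 puts `s` in `M n`, hence `n` in `I`, where `lam n ≤ C`; then the value is at
    -- most `C * K`, a contradiction.
    obtain ⟨n, B, s, hs, hB, hlt⟩ := hfC (max 1 (C * K)) (lt_max_of_lt_left one_pos)
    have hnI : n.val ∈ᵥ I :=
      (hI _).2 ⟨n.mem, s, (hM _ _).2 ⟨hs, B, hB, (le_max_left _ _).trans hlt.le⟩⟩
    have h1 : lam n * f (El.mkPair n B) ≤ lam n * K :=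
      mul_le_mul_of_nonneg_left (hK _) (hpos n).le
    have h2 : lam n * K ≤ C * K := mul_le_mul_of_nonneg_right (hC n hnI) hK0.le
    exact absurd hlt (not_lt.2 ((h1.trans h2).trans (le_max_right _ _)))
  · intro i n hin
    have hn : (⟨i.val, hIω i⟩ : El (omega V)) = n := El.ext hin
    have hMne : ∃ z, z ∈ᵥ M ⟨i.val, hIω i⟩ := ((hI _).1 i.mem).2
    simp only [hn] at hMne ⊢
    refine ⟨fun z hz => ((hM n z).1 hz).1, hMne, ?_⟩
    obtain ⟨c, hc, hcd, hc0, hcs⟩ := exists_isNatCast R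
    -- The finite set is `S n`, so `b = S n ∩ M n = M n`, and `|M n| ≤ lam n * f_n(M n) ≤ lam n *
    -- K`.
    obtain ⟨k, b, hb, hk, hkb⟩ := exists_equipotent_le hf hcd hc0 hcs n (lam n)
      (M := M n) (fun s hs => ((hM n s).1 hs).2) (hfin n)
    have hbM : b.val = M n := ext_iff.2 fun z => by
      rw [hb, and_iff_right_iff_imp]
      exact fun hz => ((hM n z).1 hz).1
    refine ⟨c, hc, k, hbM ▸ hk, hkb.trans ?_⟩
    rw [mul_comm]
    exact mul_le_mul_of_nonneg_right (hK _) (hpos n).le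

end ZFModel

theorem mainTheorem7 (V : Type*) [ZFModel.EpsStructure V] [ZFModel.IsZF V]
    (hUBP : ZFModel.UniformBoundednessPrinciple V) :
    ZFModel.PartialCountableAsymptoticChoice V :=
  hUBP.partialCountableAsymptoticChoice
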